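/- Let $n\ge 1$ be an integer. For $1\le s<\infty$, $\lambda>0$ and $\beta\in\mathbb R$, let $\mathcal{LM}^s(\varphi_\lambda,w_\beta^s)$ and $W\mathcal{LM}^s(\varphi_\lambda,w_\beta^s)$ be the spaces of measurable (real- or complex-valued) functions $f$ on $\mathbb R^n$ for which, respectively, $$\|f\|_{\mathcal{LM}^s(\varphi_\lambda,w_\beta^s)}=\sup_{r>0}\left(\frac1{r^{\lambda}}\int_{B(0,r)}|f(x)|^s|x|^{\beta s}\,dx\right)^{1/s}<\infty,$$ $$\|f\|_{W\mathcal{LM}^s(\varphi_\lambda,w_\beta^s)}=\sup_{r>0}\,\sup_{t>0}\ t\left(\frac1{r^{\lambda}}\int_{\{x\in B(0,r):\,|f(x)|>t\}}|x|^{\beta s}\,dx\right)^{1/s}<\infty.$$ For $0<\alpha<n$ let $$M_\alpha f(x)=\sup_{B\ni x}\frac1{|B|^{1-\alpha/n}}\int_B|f(y)|\,dy,\qquad I_\alpha f(x)=\int_{\mathbb R^n}\frac{f(y)}{|x-y|^{n-\alpha}}\,dy,$$ where the supremum is over all the Euclidean balls $B$ containing $x$. Boundedness of $M_\alpha$ (respectively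 $I_\alpha$) from a space $X$ to a space $Y$ means that every $f\in X$ is locally integrable (respectively, that the integral defining $I_\alpha f(x)$ converges absolutely for a.e. $x$), that the image of $f$ is measurable, and that its norm in $Y$ is at most $C\|f\|_X$, with $C$ independent of $f$. **Theorem 7.3.** Let $0<\alpha<n$, $0\le\gamma\le\alpha$, $1\le p<n/\gamma$ (that is, $1\le p<\infty$ if $\gamma=0$), $\frac1p-\frac1q=\frac\gamma n$, $\lambda_1,\lambda_2>0$ and $\beta_1,\beta_2\in\mathbb R$. Consider the conditions $$\beta_2-\beta_1-\frac{n-\lambda_1}p+\frac{n-\lambda_2}q+\alpha=0,\tag{7.3}$$ $$\alpha\le\beta_1+\frac{n-\lambda_1}p<n.\tag{7.4}$$ 1. If $p>1$, then $M_\alpha$ is bounded from $\mathcal{LM}^p(\varphi_{\lambda_1},w_{\beta_1}^p)$ to $\mathcal{LM}^q(\varphi_{\lambda_2},w_{\beta_2}^q)$ if and only if (7.3) and (7.4) hold. If $p=1$ (so that $q=n/(n-\gamma)$), then $M_\alpha$ is bounded from $\mathcal{LM}^1(\varphi_{\lambda_1},w_{\beta_1})$ to $W\mathcal{LM}^{q}(\varphi_{\lambda_2},w_{\beta_2}^{q})$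 if and only if (7.3) and (7.4) hold. 2. The same statements hold for $I_\alpha$ instead of $M_\alpha$, with (7.4) replaced by $\alpha<\beta_1+\frac{n-\lambda_1}p<n$. -/

import Mathlib

open MeasureTheory
open scoped ENNReal NNReal

namespace LocalMorrey

/-- Euclidean space `ℝⁿ`. -/
abbrev E (n : ℕ) : Type := EuclideanSpace ℝ (Fin n)

/-- The norm of the weighted local Morrey space `LM^p(φ, w)`: the supremum over the balls
`B = B(0, r)` of `(φ(B)⁻¹ ∫_B |f|^p w)^{1/p}`, with values in `[0, ∞]`. A function `φ` of the balls
centered at the origin is given as a function of the radius. -/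
noncomputable def lmNorm {n : ℕ} {F : Type*} [ENorm F] (p : ℝ) (φ : ℝ → ℝ) (w : E n → ℝ)
    (f : E n → F) : ℝ≥0∞ :=
  ⨆ (r : ℝ) (_ : 0 < r),
    ((∫⁻ x in Metric.ball (0 : E n) r, ‖f x‖ₑ ^ p * ENNReal.ofReal (w x)) /
      ENNReal.ofReal (φ r)) ^ (1 / p)

/-- The quasinorm of the weak-type local Morrey space `WLM^p(φ, w)`: the supremum over `t > 0` and
the balls `B = B(0, r)` of `t w({x ∈ B : |f x| > t})^{1/p} / φ(B)^{1/p}`. -/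
noncomputable def wlmNorm {n : ℕ} {F : Type*} [ENorm F] (p : ℝ) (φ : ℝ → ℝ) (w : E n → ℝ)
    (f : E n → F) : ℝ≥0∞ :=
  ⨆ (r : ℝ) (_ : 0 < r) (t : ℝ≥0) (_ : 0 < t),
    (t : ℝ≥0∞) *
      (∫⁻ x in {x ∈ Metric.ball (0 : E n) r | (t : ℝ≥0∞) < ‖f x‖ₑ}, ENNReal.ofReal (w x)) ^ (1 / p) /
      ENNReal.ofReal (φ r) ^ (1 / p)

/-- The fractional maximal operator: the supremum over all the balls `B` containing `x` of
`|B|^{α/n - 1} ∫_B |f|`. -/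
noncomputable def fracMax {n : ℕ} {𝕜 : Type*} [RCLike 𝕜] (α : ℝ) (f : E n → 𝕜) (x : E n) : ℝ≥0∞ :=
  ⨆ (c : E n) (r : ℝ) (_ : x ∈ Metric.ball c r),
    (∫⁻ y in Metric.ball c r, ‖f y‖ₑ) / volume (Metric.ball c r) ^ (1 - α / n)

/-- The integrand `f(y) / |x - y|^{n - α}` of the fractional integral. -/
noncomputable def fracIntegrand {n : ℕ} {𝕜 : Type*} [RCLike 𝕜] (α : ℝ) (f : E n → 𝕜) (x y : E n) :
    𝕜 :=
  (‖x - y‖ ^ ((n : ℝ) - α))⁻¹ • f y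

/-- The fractional integral `I_α f(x) = ∫ f(y) / |x - y|^{n - α} dy`. -/
noncomputable def fracInt {n : ℕ} {𝕜 : Type*} [RCLike 𝕜] (α : ℝ) (f : E n → 𝕜) (x : E n) : 𝕜 :=
  ∫ y, fracIntegrand α f x y

/-- `M_α` is well defined at `f`: the function `f` is locally integrable. -/
def FracMaxDefined {n : ℕ} {𝕜 : Type*} [RCLike 𝕜] (f : E n → 𝕜) : Prop :=
  LocallyIntegrable f volume

/-- `I_α` is well defined at `f`: the integral converges absolutely for almost every `x`. -/
def FracIntDefined {n : ℕ} {𝕜 : Type*} [RCLike 𝕜] (α : ℝ) (f : E n → 𝕜) : Prop :=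
  ∀ᵐ x : E n, Integrable (fracIntegrand α f x) volume

/-- Boundedness of an operator `T`, with domain given by `Dom`, from the space of the measurable
functions with `N₁ f < ∞` to the space of the measurable functions with `N₂ g < ∞`: the operator is
defined on all of the first space, takes it to measurable functions, and `N₂ (T f) ≤ C N₁ f`. -/
def BoundedOp {n : ℕ} {𝕜 F : Type*} [RCLike 𝕜] [TopologicalSpace F]
    (T : (E n → 𝕜) → E n → F) (Dom : (E n → 𝕜) → Prop)
    (N₁ : (E n → 𝕜) → ℝ≥0∞) (N₂ : (E n → F) → ℝ≥0∞) : Prop :=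
  ∃ C : ℝ≥0, ∀ f : E n → 𝕜, AEStronglyMeasurable f volume → N₁ f < ∞ →
    Dom f ∧ AEStronglyMeasurable (T f) volume ∧ N₂ (T f) ≤ C * N₁ f

/-- The function `φ_lam(B) = r_B ^ lam`, as a function of the radius. -/
noncomputable def samko (lam : ℝ) (r : ℝ) : ℝ := r ^ lam

/-- The `s`-th power of the power weight `w_β(x) = |x| ^ β`. -/
noncomputable def powerWeight {n : ℕ} (β s : ℝ) (x : E n) : ℝ := (‖x‖ ^ β) ^ s

end LocalMorrey

open LocalMorrey

open MeasureTheory Metric Set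
open scoped ENNReal NNReal

namespace LocalMorrey

variable {n : ℕ} {𝕜 : Type*} [RCLike 𝕜]

/-! Put `d = β₁ + (n - lam₁) / p`. The power `|x| ^ (-d)` is the model element of the source space,
and all that sufficiency uses of `f` is that its `L^p` norm on each annulus `|y| ~ ρ` is at most a
multiple of that of `N |y| ^ (-d)` (`exists_dyadicBound_of_lmNorm`).

Fix `x` and split `∫ |f(y)| |x - y| ^ (α - n) dy`. Away from `B(x, |x|/2)` the kernel is like `|x| ^
(α - n)` for `|y| < |x|` and like `|y| ^ (α - n)` for `|y| ≥ |x|`. Hölder on dyadic annuli gives two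
geometric series, convergent because `d < n` and `α < d`, each bounded by `N |x| ^ (α - d)`
(`exists_lintegral_kernel_le`). An average of `M_α` over a ball of radius `r ≥ |x|/8` is at most a
multiple of `N r ^ (α - d)`; no series runs to infinity, so `α ≤ d` is enough (`exists_average_le`).

The local part, over `B(x, |x|/2)`, sees `f` only on an annulus of size `ρ ~ |x|`. Trading `|x - y|
^ (α - γ)` for `ρ ^ (α - γ)` leaves an integral of order `γ`. Hedberg's inequality bounds this by
`(Mf) ^ (p/q) ‖f‖_p ^ (1 - p/q)`; for `γ = 0` the maximal function alone is enough. The strong `(p,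
p)` or weak `(1, 1)` maximal theorem then gives the power `ρ ^ ((α - d) q + n)` on the annulus
(`exists_lintegral_annulus_rpow_le`, `exists_volume_annulus_le`). By the homogeneity condition the
weight turns it into `ρ ^ lam₂`, which is summable over the annuli in `B(0, r)` since `lam₂ > 0`.

For necessity the weak bound is enough. Characteristic functions of annuli at all scales force
homogeneity (`scaling_of_boundedOp`). The function `|x| ^ (-d)` forces the range of `d`: it is not
locally integrable if `d ≥ n`, `M_α` of it is identically infinite if `d < α`, and its fractional
integral diverges if `d ≤ α` or `d ≥ n`. -/

lemma measurable_iSup_ball {X : Type*} [PseudoMetricSpace X] [MeasurableSpace X]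
    [OpensMeasurableSpace X] (a : X → ℝ → ℝ≥0∞) :
    Measurable fun x => ⨆ (c : X) (r : ℝ) (_ : x ∈ ball c r), a c r := by
  -- Balls are open, so a ball witnessing a value above `t` at `x` does so at nearby points; nothing
  -- is required of `a`.
  apply LowerSemicontinuous.measurable
  intro x t ht
  simp only [lt_iSup_iff] at ht ⊢
  obtain ⟨c, r, hx, h⟩ := ht
  filter_upwards [isOpen_ball.mem_nhds hx] with y hy using ⟨c, r, hy, h⟩

/-! ### Geometric sums over dyadic annuli -/

lemma two_inv_rpow_lt_one {s : ℝ} (hs : 0 < s) : (2⁻¹ : ℝ≥0∞) ^ s < 1 :=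
  ENNReal.rpow_lt_one (by simp) hs

lemma tsum_two_inv_rpow_ne_top {s : ℝ} (hs : 0 < s) :
    ∑' j : ℕ, ((2⁻¹ : ℝ≥0∞) ^ s) ^ j ≠ ⊤ := by
  rw [ENNReal.tsum_geometric]
  simpa [tsub_eq_zero_iff_le] using (two_inv_rpow_lt_one hs)

/-- A measure whose dyadic annuli around `x` of radius `ρ` have mass at most `A ρ ^ s`, `s > 0`,
gives mass at most a multiple of `A δ ^ s` to the ball of radius `δ`. -/
lemma measure_ball_le_of_annuli {X : Type*} [MetricSpace X] [MeasurableSpace X] {s : ℝ}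
    (hs : 0 < s) :
    ∃ C : ℝ≥0, ∀ (μ : Measure X) (x : X) (A : ℝ≥0∞), μ {x} = 0 →
      (∀ ρ : ℝ, 0 < ρ → μ (ball x (2 * ρ) \ ball x ρ) ≤ A * ENNReal.ofReal ρ ^ s) →
      ∀ δ : ℝ, 0 < δ → μ (ball x δ) ≤ C * (A * ENNReal.ofReal δ ^ s) := by
  refine ⟨(∑' j : ℕ, ((2⁻¹ : ℝ≥0∞) ^ s) ^ j).toNNReal, fun μ x A h0 h δ hδ => ?_⟩
  rw [ENNReal.coe_toNNReal (tsum_two_inv_rpow_ne_top hs)]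
  -- The inner radii start at `δ / 2`, so the annuli fill the ball of radius `δ` except for its
  -- center.
  have hsub : ball x δ ⊆ {x} ∪ ⋃ j : ℕ, ball x (2 * (δ * 2⁻¹ ^ (j + 1))) \
      ball x (δ * 2⁻¹ ^ (j + 1)) := by
    intro y hy
    rcases eq_or_ne y x with rfl | hne
    · simp
    right
    have hd : 0 < dist y x := dist_pos.2 hne
    have hex : ∃ j : ℕ, δ * 2⁻¹ ^ j ≤ dist y x := by
      obtain ⟨j, hj⟩ := exists_pow_lt_of_lt_one (div_pos hd hδ) (by norm_num : (2⁻¹ : ℝ) < 1)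
      exact ⟨j, by rw [lt_div_iff₀ hδ] at hj; linarith⟩
    classical
    obtain ⟨k, hk⟩ : ∃ k, Nat.find hex = k + 1 := by
      refine Nat.exists_eq_succ_of_ne_zero fun h0 => ?_
      have := Nat.find_spec hex
      rw [h0, pow_zero, mul_one] at this
      exact absurd (mem_ball.1 hy) (not_lt.2 this)
    have h1 := Nat.find_spec hex
    have h2 := Nat.find_min hex (m := k) (by omega)
    rw [hk] at h1
    refine mem_iUnion.2 ⟨k, ?_, ?_⟩
    · rw [mem_ball, pow_succ]
      rw [not_le] at h2
      linarith
    · rw [mem_ball, not_lt]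
      exact h1
  calc μ (ball x δ) ≤ μ {x} + ∑' j : ℕ, μ (ball x (2 * (δ * 2⁻¹ ^ (j + 1))) \
      ball x (δ * 2⁻¹ ^ (j + 1))) :=
        (measure_mono hsub).trans ((measure_union_le _ _).trans
          (by gcongr; exact measure_iUnion_le _))
    _ ≤ ∑' j : ℕ, ((2⁻¹ : ℝ≥0∞) ^ s) ^ j * (A * ENNReal.ofReal δ ^ s) := by
        rw [h0, zero_add]
        refine ENNReal.tsum_le_tsum fun j => ?_
        refine (h _ (by positivity)).trans ?_
        rw [ENNReal.ofReal_mul hδ.le, ENNReal.mul_rpow_of_nonneg _ _ hs.le,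
          ENNReal.ofReal_pow (by norm_num), ENNReal.ofReal_inv_of_pos (by norm_num),
          ENNReal.ofReal_ofNat, ← ENNReal.rpow_natCast, ← ENNReal.rpow_mul,
          mul_comm ((j + 1 : ℕ) : ℝ) s, ENNReal.rpow_mul, ENNReal.rpow_natCast]
        calc A * (ENNReal.ofReal δ ^ s * ((2⁻¹ : ℝ≥0∞) ^ s) ^ (j + 1))
            ≤ A * (ENNReal.ofReal δ ^ s * ((2⁻¹ : ℝ≥0∞) ^ s) ^ j) := by
              gcongr A * (_ * ?_)
              rw [pow_succ]
              exact mul_le_of_le_one_right' (two_inv_rpow_lt_one hs).le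
          _ = _ := by ring
    _ = _ := ENNReal.tsum_mul_right

/-- A measure whose dyadic annuli around `x` of radius `ρ` have mass at most `A ρ ^ s`, `s < 0`,
gives mass at most a multiple of `A δ ^ s` to the complement of the ball of radius `δ`. -/
lemma measure_compl_ball_le_of_annuli {X : Type*} [MetricSpace X] [MeasurableSpace X] {s : ℝ}
    (hs : s < 0) :
    ∃ C : ℝ≥0, ∀ (μ : Measure X) (x : X) (A : ℝ≥0∞),
      (∀ ρ : ℝ, 0 < ρ → μ (ball x (2 * ρ) \ ball x ρ) ≤ A * ENNReal.ofReal ρ ^ s) →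
      ∀ δ : ℝ, 0 < δ → μ (ball x δ)ᶜ ≤ C * (A * ENNReal.ofReal δ ^ s) := by
  have hs' : 0 < -s := neg_pos.2 hs
  refine ⟨(∑' j : ℕ, ((2⁻¹ : ℝ≥0∞) ^ (-s)) ^ j).toNNReal, fun μ x A h δ hδ => ?_⟩
  rw [ENNReal.coe_toNNReal (tsum_two_inv_rpow_ne_top hs')]
  have hsub : (ball x δ)ᶜ ⊆ ⋃ j : ℕ, ball x (2 * (δ * 2 ^ j)) \ ball x (δ * 2 ^ j) := by
    intro y hy
    rw [mem_compl_iff, mem_ball, not_lt] at hy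
    obtain ⟨j, h1, h2⟩ := exists_nat_pow_near ((one_le_div hδ).2 hy) (by norm_num : (1 : ℝ) < 2)
    rw [le_div_iff₀ hδ] at h1
    rw [div_lt_iff₀ hδ, pow_succ] at h2
    refine mem_iUnion.2 ⟨j, ?_, ?_⟩
    · rw [mem_ball]; linarith
    · rw [mem_ball, not_lt]; linarith
  calc μ (ball x δ)ᶜ ≤ ∑' j : ℕ, μ (ball x (2 * (δ * 2 ^ j)) \ ball x (δ * 2 ^ j)) :=
        (measure_mono hsub).trans (measure_iUnion_le _)
    _ ≤ ∑' j : ℕ, ((2⁻¹ : ℝ≥0∞) ^ (-s)) ^ j * (A * ENNReal.ofReal δ ^ s) := by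
        refine ENNReal.tsum_le_tsum fun j => ?_
        refine (h _ (by positivity)).trans (le_of_eq ?_)
        rw [ENNReal.ofReal_mul hδ.le, ENNReal.mul_rpow_of_ne_top (by simp) (by simp),
          ENNReal.ofReal_pow (by norm_num),
          ENNReal.ofReal_ofNat, ← ENNReal.rpow_natCast, ← ENNReal.rpow_mul,
          mul_comm (j : ℝ) s, ENNReal.rpow_mul, ENNReal.rpow_natCast, ENNReal.inv_rpow,
          ENNReal.rpow_neg, inv_inv]
        ring
    _ = _ := ENNReal.tsum_mul_right

/-- Powers of comparable numbers are comparable. -/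
lemma exists_rpow_le_of_comparable (e : ℝ) :
    ∃ C : ℝ≥0, 0 < C ∧ ∀ ρ t : ℝ, 0 < ρ → ρ ≤ 4 * t → t ≤ 4 * ρ →
      ENNReal.ofReal t ^ e ≤ C * ENNReal.ofReal ρ ^ e := by
  -- One constant serves both signs of `e`: `t ≤ 4 ρ` is used for `e ≥ 0`, and `ρ ≤ 4 t` for `e <
  -- 0`.
  refine ⟨4 ^ |e|, by positivity, fun ρ t hρ h1 h2 => ?_⟩
  have ht : 0 < t := by linarith
  have hc : (((4 : ℝ≥0) ^ |e| : ℝ≥0) : ℝ≥0∞) = ENNReal.ofReal (4 ^ |e|) := by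
    rw [ENNReal.coe_rpow_of_nonneg _ (abs_nonneg e), ← ENNReal.ofReal_rpow_of_pos (by norm_num)]
    simp
  rw [hc, ENNReal.ofReal_rpow_of_pos ht, ENNReal.ofReal_rpow_of_pos hρ,
    ← ENNReal.ofReal_mul (by positivity)]
  apply ENNReal.ofReal_le_ofReal
  rcases le_or_gt 0 e with he | he
  · rw [abs_of_nonneg he, ← Real.mul_rpow (by norm_num) hρ.le]
    exact Real.rpow_le_rpow ht.le h2 he
  · rw [abs_of_neg he, Real.rpow_neg (by norm_num), ← Real.inv_rpow (by norm_num),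
      ← Real.mul_rpow (by norm_num) hρ.le]
    exact Real.rpow_le_rpow_of_nonpos (by positivity) (by linarith) he.le

lemma ofReal_rpow_ne_zero {ρ : ℝ} (hρ : 0 < ρ) (s : ℝ) : ENNReal.ofReal ρ ^ s ≠ 0 := by
  simp [ENNReal.rpow_eq_zero_iff, hρ]

lemma ofReal_rpow_ne_top {ρ : ℝ} (hρ : 0 < ρ) (s : ℝ) : ENNReal.ofReal ρ ^ s ≠ ⊤ := by
  simp [ENNReal.rpow_eq_top_iff, hρ]

lemma ofReal_rpow_add {ρ : ℝ} (hρ : 0 < ρ) (s t : ℝ) :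
    ENNReal.ofReal ρ ^ (s + t) = ENNReal.ofReal ρ ^ s * ENNReal.ofReal ρ ^ t :=
  ENNReal.rpow_add _ _ (by simpa using hρ) (by simp)


/-! ### The Hardy–Littlewood maximal theorem -/

/-- The volume of the unit ball. -/
noncomputable def unitVol (n : ℕ) : ℝ≥0∞ := volume (ball (0 : E n) 1)

lemma unitVol_ne_top : unitVol n ≠ ⊤ := measure_ball_lt_top.ne

lemma unitVol_ne_zero : unitVol n ≠ 0 := (measure_ball_pos _ _ one_pos).ne'

lemma volume_ball_eq (c : E n) {r : ℝ} (hr : 0 < r) :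
    volume (ball c r) = ENNReal.ofReal r ^ (n : ℝ) * unitVol n := by
  rw [Measure.addHaar_ball_of_pos _ _ hr, ENNReal.ofReal_pow hr.le, ENNReal.rpow_natCast, unitVol]
  simp

lemma volume_closedBall_eq (c : E n) {r : ℝ} (hr : 0 < r) :
    volume (closedBall c r) = ENNReal.ofReal r ^ (n : ℝ) * unitVol n := by
  rw [Measure.addHaar_closedBall _ _ hr.le, ENNReal.ofReal_pow hr.le, ENNReal.rpow_natCast,
    unitVol]
  simp

/-- The uncentered Hardy–Littlewood maximal function, normalized by `r ^ n`. -/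
noncomputable def maxFn (g : E n → ℝ≥0∞) (x : E n) : ℝ≥0∞ :=
  ⨆ (c : E n) (r : ℝ) (_ : x ∈ ball c r),
    (∫⁻ y in ball c r, g y) / ENNReal.ofReal r ^ (n : ℝ)

lemma measurable_maxFn (g : E n → ℝ≥0∞) : Measurable (maxFn g) :=
  measurable_iSup_ball fun c r => (∫⁻ y in ball c r, g y) / ENNReal.ofReal r ^ (n : ℝ)

lemma lintegral_ball_le_maxFn (g : E n → ℝ≥0∞) {x c : E n} {r : ℝ} (hx : x ∈ ball c r) :
    ∫⁻ y in ball c r, g y ≤ maxFn g x * ENNReal.ofReal r ^ (n : ℝ) := by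
  have hr : 0 < r := pos_of_mem_ball hx
  rw [← ENNReal.div_le_iff (ofReal_rpow_ne_zero hr _) (ofReal_rpow_ne_top hr _)]
  exact le_iSup₂_of_le c r (le_iSup_of_le hx le_rfl)

lemma maxFn_congr_ae {g h : E n → ℝ≥0∞} (hgh : g =ᵐ[volume] h) : maxFn g = maxFn h := by
  funext x
  simp only [maxFn]
  congr! 6 with c r hx
  exact lintegral_congr_ae (ae_restrict_of_ae hgh)

/-- The weak type `(1, 1)` inequality. -/
lemma exists_mul_volume_maxFn_le (hn : 0 < n) :
    ∃ C : ℝ≥0, ∀ (g : E n → ℝ≥0∞) (t : ℝ≥0∞),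
      t * volume {x | t < maxFn g x} ≤ C * ∫⁻ y, g y := by
  have hn' : (0 : ℝ) < n := by exact_mod_cast hn
  set K : ℝ≥0∞ := (5 : ℝ≥0∞) ^ (n : ℝ) * unitVol n with hK
  have hKt : K ≠ ⊤ := ENNReal.mul_ne_top (by simp) unitVol_ne_top
  have hK0 : K ≠ 0 := mul_ne_zero (by simp) unitVol_ne_zero
  refine ⟨K.toNNReal, fun g t => ?_⟩
  rw [ENNReal.coe_toNNReal hKt]
  rcases eq_or_ne t 0 with rfl | ht0
  · simp
  rcases eq_or_ne t ⊤ with rfl | htt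
  · simp
  rcases eq_or_ne (∫⁻ y, g y) ⊤ with hI | hI
  · rw [hI, ENNReal.mul_top hK0]; exact le_top
  let S : Set (E n × ℝ) := {a | 0 < a.2 ∧
    t * ENNReal.ofReal a.2 ^ (n : ℝ) < ∫⁻ y in ball a.1 a.2, g y}
  -- Vitali's lemma needs bounded radii; a ball in `S` has `t r ^ n < ∫ g`, which is finite here.
  have hbd : ∀ a ∈ S, a.2 ≤ (((∫⁻ y, g y) / t) ^ (n : ℝ)⁻¹).toReal := by
    intro a ha
    rw [← ENNReal.ofReal_le_iff_le_toReal
      (ENNReal.rpow_ne_top_of_nonneg (by positivity) (ENNReal.div_ne_top hI ht0)),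
      ENNReal.le_rpow_inv_iff hn', ENNReal.le_div_iff_mul_le (.inl ht0) (.inl htt), mul_comm]
    exact ha.2.le.trans (setLIntegral_le_lintegral _ _)
  obtain ⟨u, huS, hdisj, hcov⟩ := Vitali.exists_disjoint_subfamily_covering_enlargement_closedBall
    S (fun a => a.1) (fun a => a.2) _ hbd 5 (by norm_num)
  have hcount : u.Countable := hdisj.countable_of_nonempty_interior fun a ha => by
    refine ⟨a.1, ?_⟩
    exact interior_mono ball_subset_closedBall
      (by rw [isOpen_ball.interior_eq]; exact mem_ball_self (huS ha).1)
  have hsub : {x | t < maxFn g x} ⊆ ⋃ a ∈ u, closedBall a.1 (5 * a.2) := by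
    intro x hx
    simp only [mem_ofPred_eq, maxFn, lt_iSup_iff] at hx
    obtain ⟨c, r, hxc, h⟩ := hx
    have hr : 0 < r := pos_of_mem_ball hxc
    rw [ENNReal.lt_div_iff_mul_lt (.inl (ofReal_rpow_ne_zero hr _))
      (.inl (ofReal_rpow_ne_top hr _))] at h
    obtain ⟨b, hb, hsub⟩ := hcov (c, r) ⟨hr, h⟩
    exact mem_biUnion hb (hsub (ball_subset_closedBall hxc))
  have := hcount.to_subtype
  calc t * volume {x | t < maxFn g x}
      ≤ t * ∑' a : u, volume (closedBall a.1.1 (5 * a.1.2)) := by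
        gcongr
        exact (measure_mono hsub).trans (measure_biUnion_le _ hcount _)
    _ = ∑' a : u, t * volume (closedBall a.1.1 (5 * a.1.2)) := ENNReal.tsum_mul_left.symm
    _ ≤ ∑' a : u, K * ∫⁻ y in ball a.1.1 a.1.2, g y := by
        refine ENNReal.tsum_le_tsum fun a => ?_
        obtain ⟨h1, h2⟩ := huS a.2
        rw [volume_closedBall_eq _ (by positivity), ENNReal.ofReal_mul (by norm_num),
          ENNReal.mul_rpow_of_nonneg _ _ hn'.le, ENNReal.ofReal_ofNat]
        calc t * (5 ^ (n : ℝ) * ENNReal.ofReal a.1.2 ^ (n : ℝ) * unitVol n)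
            = K * (t * ENNReal.ofReal a.1.2 ^ (n : ℝ)) := by rw [hK]; ring
          _ ≤ _ := by gcongr
    _ = K * ∑' a : u, ∫⁻ y in ball a.1.1 a.1.2, g y := ENNReal.tsum_mul_left
    _ = K * ∫⁻ y in ⋃ a ∈ u, ball a.1 a.2, g y := by
        rw [lintegral_biUnion hcount (fun a _ => measurableSet_ball)
          (hdisj.mono fun a => ball_subset_closedBall)]
    _ ≤ _ := by gcongr; exact Measure.restrict_le_self

lemma lintegral_Ioo_rpow {s : ℝ} (hs : 0 < s) {a : ℝ} (ha : 0 ≤ a) :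
    ∫⁻ t in Ioo 0 a, ENNReal.ofReal (t ^ (s - 1)) = ENNReal.ofReal a ^ s / ENNReal.ofReal s := by
  rw [← ofReal_integral_eq_lintegral_ofReal, ← integral_Ioc_eq_integral_Ioo,
    ← intervalIntegral.integral_of_le ha, integral_rpow (.inl (by linarith)), sub_add_cancel,
    Real.zero_rpow hs.ne', sub_zero, ENNReal.ofReal_div_of_pos hs,
    ENNReal.ofReal_rpow_of_nonneg ha hs.le]
  · exact ((intervalIntegrable_iff_integrableOn_Ioc_of_le ha).1
      (intervalIntegral.intervalIntegrable_rpow' (by linarith))).mono_set Ioo_subset_Ioc_self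
  · filter_upwards [ae_restrict_mem measurableSet_Ioo] with t ht using Real.rpow_nonneg ht.1.le _

/-- The layer cake formula for the function `u ↦ u ^ s` of `u : ℝ≥0∞`. -/
lemma lintegral_indicator_rpow {s : ℝ} (hs : 0 < s) (u : ℝ≥0∞) :
    ∫⁻ t in Ioi (0 : ℝ), (if ENNReal.ofReal t < u then ENNReal.ofReal (t ^ (s - 1)) else 0) =
      u ^ s / ENNReal.ofReal s := by
  have key : ∀ a : ℝ, 0 ≤ a →
      ∫⁻ t in Ioi (0 : ℝ), (if ENNReal.ofReal t < ENNReal.ofReal a then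
        ENNReal.ofReal (t ^ (s - 1)) else 0) = ENNReal.ofReal a ^ s / ENNReal.ofReal s := by
    intro a ha
    rw [← lintegral_Ioo_rpow hs ha, ← Ioi_inter_Iio, inter_comm,
      ← setLIntegral_indicator measurableSet_Iio]
    refine setLIntegral_congr_fun measurableSet_Ioi fun t ht => ?_
    simp only [indicator, mem_Iio]
    congr 1
    simp only [eq_iff_iff]
    constructor
    · exact fun h => lt_of_not_ge fun h' => absurd h (not_lt.2 (ENNReal.ofReal_le_ofReal h'))
    · exact fun h => (ENNReal.ofReal_lt_ofReal_iff_of_nonneg (le_of_lt ht)).2 h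
  rcases eq_or_ne u ⊤ with rfl | hu
  · rw [ENNReal.top_rpow_of_pos hs, ENNReal.top_div_of_ne_top ENNReal.ofReal_ne_top]
    -- For `u = ⊤` compare with the finite height `a = (r s) ^ (1/s)`, at which the integral equals
    -- `r`.
    refine ENNReal.eq_top_of_forall_nnreal_le fun r => ?_
    have hr : (r : ℝ≥0∞) = ENNReal.ofReal ((r * s) ^ s⁻¹) ^ s / ENNReal.ofReal s := by
      have : 0 ≤ (r : ℝ) * s := by positivity
      rw [ENNReal.ofReal_rpow_of_nonneg (by positivity) hs.le, Real.rpow_inv_rpow this hs.ne',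
        ← ENNReal.ofReal_div_of_pos hs, mul_div_cancel_right₀ _ hs.ne']
      simp
    rw [hr, ← key _ (by positivity)]
    refine lintegral_mono fun t => ?_
    simp only [ENNReal.ofReal_lt_top, if_true]
    split_ifs <;> simp
  · rw [← ENNReal.ofReal_toReal hu]
    exact key _ ENNReal.toReal_nonneg

/-- Values of `g` up to `t / (2 |B(0, 1)|)` add at most `t / 2` to an average normalized by `r ^ n`.
Where the maximal function exceeds `t`, that of the remaining large part therefore exceeds `t / 2`,
and the weak type inequality applies to it. This is the truncation step of Marcinkiewicz
interpolation. -/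
lemma volume_lt_maxFn_le_truncated {n : ℕ} {C : ℝ≥0}
    (hC : ∀ (g : E n → ℝ≥0∞) (t : ℝ≥0∞), t * volume {x | t < maxFn g x} ≤ C * ∫⁻ y, g y)
    {g : E n → ℝ≥0∞} (hg : Measurable g) {t : ℝ≥0∞} (ht : t ≠ ⊤) (h0 : t ≠ 0) :
    volume {x | t < maxFn g x} ≤
      2 * C / t * ∫⁻ y in {y | t < 2 * unitVol n * g y}, g y := by
  have hms : MeasurableSet {y | t < 2 * unitVol n * g y} :=
    measurableSet_lt measurable_const (hg.const_mul _)
  have hv0 : 2 * unitVol n ≠ 0 := mul_ne_zero (by simp) unitVol_ne_zero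
  have hvt : 2 * unitVol n ≠ ⊤ := ENNReal.mul_ne_top (by simp) unitVol_ne_top
  have h2 : t / 2 ≠ 0 := by simp [h0]
  have h2t : t / 2 ≠ ⊤ := ENNReal.div_ne_top ht (by simp)
  have hsub : {x | t < maxFn g x} ⊆
      {x | t / 2 < maxFn ({y | t < 2 * unitVol n * g y}.indicator g) x} := by
    intro x hx
    simp only [mem_ofPred_eq] at hx ⊢
    by_contra! hle
    refine absurd hx (not_lt.2 (iSup₂_le fun c r => iSup_le fun hxc => ?_))
    have hr : 0 < r := pos_of_mem_ball hxc
    rw [ENNReal.div_le_iff (ofReal_rpow_ne_zero hr _) (ofReal_rpow_ne_top hr _)]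
    calc ∫⁻ y in ball c r, g y
        ≤ ∫⁻ y in ball c r, ({y | t < 2 * unitVol n * g y}.indicator g y +
            t / (2 * unitVol n)) := by
          refine lintegral_mono fun y => ?_
          simp only [indicator, mem_ofPred_eq]
          split_ifs with h
          · exact le_self_add
          · rw [zero_add, ENNReal.le_div_iff_mul_le (.inl hv0) (.inl hvt), mul_comm]
            exact not_lt.1 h
      _ = (∫⁻ y in ball c r, {y | t < 2 * unitVol n * g y}.indicator g y) +
            t / (2 * unitVol n) * (ENNReal.ofReal r ^ (n : ℝ) * unitVol n) := by
          rw [lintegral_add_right _ measurable_const, setLIntegral_const, volume_ball_eq _ hr]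
      _ ≤ t / 2 * ENNReal.ofReal r ^ (n : ℝ) + t / 2 * ENNReal.ofReal r ^ (n : ℝ) := by
          gcongr ?_ + ?_
          · exact (lintegral_ball_le_maxFn _ hxc).trans (by gcongr)
          · apply le_of_eq
            rw [ENNReal.div_eq_inv_mul, ENNReal.div_eq_inv_mul,
              ENNReal.mul_inv (.inl (by simp)) (.inl (by simp))]
            calc 2⁻¹ * (unitVol n)⁻¹ * t * (ENNReal.ofReal r ^ (n : ℝ) * unitVol n)
                = 2⁻¹ * t * ENNReal.ofReal r ^ (n : ℝ) * ((unitVol n)⁻¹ * unitVol n) := by ring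
              _ = _ := by
                rw [ENNReal.inv_mul_cancel unitVol_ne_zero unitVol_ne_top, mul_one]
      _ = _ := by rw [← add_mul, ENNReal.add_halves]
  have := hC ({y | t < 2 * unitVol n * g y}.indicator g) (t / 2)
  rw [lintegral_indicator hms] at this
  calc volume {x | t < maxFn g x}
      ≤ volume {x | t / 2 < maxFn ({y | t < 2 * unitVol n * g y}.indicator g) x} :=
        measure_mono hsub
    _ ≤ (C * ∫⁻ y in {y | t < 2 * unitVol n * g y}, g y) / (t / 2) := by
        rwa [ENNReal.le_div_iff_mul_le (.inl h2) (.inl h2t), mul_comm]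
    _ = _ := by
        rw [ENNReal.div_eq_inv_mul, ENNReal.inv_div (.inl (by simp)) (.inl (by simp)),
          ENNReal.div_eq_inv_mul, ENNReal.div_eq_inv_mul]
        ring

/-- The strong type `(p, p)` inequality, `p > 1`. -/
lemma exists_lintegral_maxFn_rpow_le (hn : 0 < n) {p : ℝ} (hp : 1 < p) :
    ∃ C : ℝ≥0, ∀ g : E n → ℝ≥0∞, AEMeasurable g →
      ∫⁻ x, maxFn g x ^ p ≤ C * ∫⁻ y, g y ^ p := by
  obtain ⟨C, hC⟩ := exists_mul_volume_maxFn_le hn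
  have hp0 : 0 < p := by linarith
  have hp1 : 0 < p - 1 := by linarith
  -- The factor `p` comes from the layer cake formula, `2 C` from the truncated weak bound, and the
  -- last factor from `∫ t ^ (p - 2) dt` over `0 < t < 2 |B(0, 1)| g(x)`.
  set K : ℝ≥0∞ := ENNReal.ofReal p * (2 * C) * ((2 * unitVol n) ^ (p - 1) / ENNReal.ofReal (p - 1))
    with hK
  have hKt : K ≠ ⊤ := by
    refine ENNReal.mul_ne_top (by finiteness) (ENNReal.div_ne_top
      (ENNReal.rpow_ne_top_of_nonneg hp1.le
        (ENNReal.mul_ne_top (by simp) unitVol_ne_top)) (by simpa using hp))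
  refine ⟨K.toNNReal, fun g₀ hg₀ => ?_⟩
  rw [ENNReal.coe_toNNReal hKt]
  set g := hg₀.mk g₀
  have hg : Measurable g := hg₀.measurable_mk
  rw [maxFn_congr_ae hg₀.ae_eq_mk,
    lintegral_congr_ae (f := fun y => g₀ y ^ p) (g := fun y => g y ^ p)
      (hg₀.ae_eq_mk.mono fun x hx => congrArg (· ^ p) hx)]
  have hM := measurable_maxFn g
  have hmt : Measurable fun t : ℝ => ENNReal.ofReal (t ^ (p - 1)) := by fun_prop
  calc ∫⁻ x, maxFn g x ^ p
      = ENNReal.ofReal p * ∫⁻ x, ∫⁻ t in Ioi (0 : ℝ),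
          (if ENNReal.ofReal t < maxFn g x then ENNReal.ofReal (t ^ (p - 1)) else 0) := by
        simp_rw [lintegral_indicator_rpow hp0]
        rw [← lintegral_const_mul _ (by fun_prop)]
        refine lintegral_congr fun x => ?_
        rw [ENNReal.mul_div_cancel (by simpa using hp0) (by simp)]
    _ = ENNReal.ofReal p * ∫⁻ t in Ioi (0 : ℝ), ∫⁻ x,
          (if ENNReal.ofReal t < maxFn g x then ENNReal.ofReal (t ^ (p - 1)) else 0) := by
        congr 1
        refine lintegral_lintegral_swap (Measurable.aemeasurable ?_)
        exact Measurable.ite (measurableSet_lt (by fun_prop) (hM.comp measurable_fst))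
          (hmt.comp measurable_snd) measurable_const
    _ ≤ ENNReal.ofReal p * ∫⁻ t in Ioi (0 : ℝ), 2 * C * ∫⁻ x,
          (if ENNReal.ofReal t < 2 * unitVol n * g x then
            g x * ENNReal.ofReal (t ^ (p - 1 - 1)) else 0) := by
        gcongr ENNReal.ofReal p * ?_
        refine setLIntegral_mono' measurableSet_Ioi fun t ht => ?_
        have ht : 0 < t := ht
        have h0 : ENNReal.ofReal t ≠ 0 := by simpa using ht
        have e1 : ∀ x, (if ENNReal.ofReal t < maxFn g x then ENNReal.ofReal (t ^ (p - 1)) else 0) =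
            {x | ENNReal.ofReal t < maxFn g x}.indicator
              (fun _ => ENNReal.ofReal (t ^ (p - 1))) x := fun x => by simp [indicator]
        have e2 : ∀ x, (if ENNReal.ofReal t < 2 * unitVol n * g x then
            g x * ENNReal.ofReal (t ^ (p - 1 - 1)) else 0) =
            {x | ENNReal.ofReal t < 2 * unitVol n * g x}.indicator
              (fun x => g x * ENNReal.ofReal (t ^ (p - 1 - 1))) x := fun x => by simp [indicator]
        simp_rw [e1, e2]
        rw [lintegral_indicator_const (measurableSet_lt measurable_const hM),
          lintegral_indicator (measurableSet_lt measurable_const (hg.const_mul _)),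
          lintegral_mul_const _ hg]
        refine (mul_le_mul_right (volume_lt_maxFn_le_truncated hC hg (by simp) h0) _).trans
          (le_of_eq ?_)
        rw [Real.rpow_sub_one ht.ne' (p - 1), ENNReal.ofReal_div_of_pos ht,
          ENNReal.div_eq_inv_mul, ENNReal.div_eq_inv_mul]
        ring
    _ = ENNReal.ofReal p * (2 * C) * ∫⁻ x, ∫⁻ t in Ioi (0 : ℝ),
          (if ENNReal.ofReal t < 2 * unitVol n * g x then
            g x * ENNReal.ofReal (t ^ (p - 1 - 1)) else 0) := by
        have hm : Measurable (Function.uncurry fun (t : ℝ) (x : E n) =>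
            (if ENNReal.ofReal t < 2 * unitVol n * g x then
              g x * ENNReal.ofReal (t ^ (p - 1 - 1)) else 0)) := by
          exact Measurable.ite (measurableSet_lt (by fun_prop) (by fun_prop))
            (by fun_prop) measurable_const
        rw [lintegral_const_mul' _ _ (by finiteness), lintegral_lintegral_swap hm.aemeasurable]
        ring
    -- The inner integral in `t` converges at `0` because `p > 1`.
    _ = ENNReal.ofReal p * (2 * C) * ∫⁻ x, g x *
          ((2 * unitVol n * g x) ^ (p - 1) / ENNReal.ofReal (p - 1)) := by
        congr 1
        refine lintegral_congr fun x => ?_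
        rw [← lintegral_indicator_rpow hp1, ← lintegral_const_mul]
        · simp only [mul_ite, mul_zero]
        · exact Measurable.ite (measurableSet_lt (by fun_prop) (by fun_prop))
            (by fun_prop) measurable_const
    _ = K * ∫⁻ y, g y ^ p := by
        rw [hK, ← lintegral_const_mul _ (by fun_prop), ← lintegral_const_mul _ (by fun_prop)]
        refine lintegral_congr fun x => ?_
        have : g x ^ p = g x * g x ^ (p - 1) := by
          conv_lhs => rw [show p = 1 + (p - 1) by ring]
          rw [ENNReal.rpow_add_of_nonneg _ _ zero_le_one hp1.le, ENNReal.rpow_one]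
        rw [this, ENNReal.mul_rpow_of_nonneg _ _ hp1.le, ENNReal.div_eq_inv_mul,
          ENNReal.div_eq_inv_mul]
        ring

/-! ### Kernel estimates and Hedberg's inequality -/

/-- Hölder's inequality against the constant function `1`. -/
lemma lintegral_le_rpow_mul_volume {p : ℝ} (hp : 1 ≤ p) {g : E n → ℝ≥0∞} {S : Set (E n)}
    (hg : AEMeasurable g) :
    ∫⁻ y in S, g y ≤ (∫⁻ y in S, g y ^ p) ^ (1 / p) * volume S ^ (1 - 1 / p) := by
  have := eLpNorm'_le_eLpNorm'_mul_rpow_measure_univ (μ := volume.restrict S) one_pos hp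
    hg.restrict.aestronglyMeasurable
  simpa [eLpNorm'] using this

lemma volume_singleton_eq_zero (hn : 0 < n) (x : E n) : volume {x} = 0 := by
  have : Nonempty (Fin n) := ⟨⟨0, hn⟩⟩
  exact measure_singleton x

lemma exists_lintegral_annulus_kernel_le (e : ℝ) :
    ∃ C : ℝ≥0, ∀ (g : E n → ℝ≥0∞) (x : E n) (ρ : ℝ), 0 < ρ →
      ∫⁻ y in ball x (2 * ρ) \ ball x ρ, g y * ENNReal.ofReal ‖x - y‖ ^ e ≤
        C * ENNReal.ofReal ρ ^ e * ∫⁻ y in ball x (2 * ρ) \ ball x ρ, g y := by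
  obtain ⟨C, -, hC⟩ := exists_rpow_le_of_comparable e
  refine ⟨C, fun g x ρ hρ => ?_⟩
  rw [← lintegral_const_mul' _ _ (ENNReal.mul_ne_top (by simp) (ofReal_rpow_ne_top hρ _))]
  refine setLIntegral_mono' (measurableSet_ball.diff measurableSet_ball) fun y hy => ?_
  have h1 := mem_ball.1 hy.1
  have h2 := not_lt.1 (fun h => hy.2 (mem_ball.2 h))
  rw [dist_comm, dist_eq_norm] at h1 h2
  rw [mul_comm]
  gcongr
  exact hC ρ _ hρ (by linarith) (by linarith)

/-- The kernel is comparable to `ρ ^ e` on each annulus, so the measure `g(y) |x - y| ^ e dy` has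
annular masses of order `ρ ^ (s + e)`, which sum towards the center as `s + e > 0`. Used around a
general `x`, and around the origin with `e = 0`. -/
lemma exists_lintegral_ball_kernel_le (hn : 0 < n) {s e : ℝ} (hse : 0 < s + e) :
    ∃ C : ℝ≥0, ∀ (g : E n → ℝ≥0∞) (x : E n) (A : ℝ≥0∞),
      (∀ ρ : ℝ, 0 < ρ → ∫⁻ y in ball x (2 * ρ) \ ball x ρ, g y ≤ A * ENNReal.ofReal ρ ^ s) →
      ∀ δ : ℝ, 0 < δ → ∫⁻ y in ball x δ, g y * ENNReal.ofReal ‖x - y‖ ^ e ≤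
        C * (A * ENNReal.ofReal δ ^ (s + e)) := by
  obtain ⟨C₁, hC₁⟩ := exists_lintegral_annulus_kernel_le (n := n) e
  obtain ⟨C₂, hC₂⟩ := measure_ball_le_of_annuli (X := E n) hse
  refine ⟨C₂ * C₁, fun g x A h δ hδ => ?_⟩
  have := hC₂ (volume.withDensity fun y => g y * ENNReal.ofReal ‖x - y‖ ^ e) x (C₁ * A)
    (withDensity_absolutelyContinuous _ _ (volume_singleton_eq_zero hn x)) (fun ρ hρ => by
      rw [withDensity_apply _ (measurableSet_ball.diff measurableSet_ball)]
      refine (hC₁ g x ρ hρ).trans ?_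
      calc _ ≤ C₁ * ENNReal.ofReal ρ ^ e * (A * ENNReal.ofReal ρ ^ s) := by gcongr; exact h ρ hρ
        _ = _ := by rw [ofReal_rpow_add hρ]; ring) δ hδ
  rw [withDensity_apply _ measurableSet_ball] at this
  refine this.trans (le_of_eq ?_)
  push_cast; ring

lemma exists_lintegral_compl_ball_kernel_le {s e : ℝ} (hse : s + e < 0) :
    ∃ C : ℝ≥0, ∀ (g : E n → ℝ≥0∞) (x : E n) (A : ℝ≥0∞),
      (∀ ρ : ℝ, 0 < ρ → ∫⁻ y in ball x (2 * ρ) \ ball x ρ, g y ≤ A * ENNReal.ofReal ρ ^ s) →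
      ∀ δ : ℝ, 0 < δ → ∫⁻ y in (ball x δ)ᶜ, g y * ENNReal.ofReal ‖x - y‖ ^ e ≤
        C * (A * ENNReal.ofReal δ ^ (s + e)) := by
  obtain ⟨C₁, hC₁⟩ := exists_lintegral_annulus_kernel_le (n := n) e
  obtain ⟨C₂, hC₂⟩ := measure_compl_ball_le_of_annuli (X := E n) hse
  refine ⟨C₂ * C₁, fun g x A h δ hδ => ?_⟩
  have := hC₂ (volume.withDensity fun y => g y * ENNReal.ofReal ‖x - y‖ ^ e) x (C₁ * A)
    (fun ρ hρ => by
      rw [withDensity_apply _ (measurableSet_ball.diff measurableSet_ball)]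
      refine (hC₁ g x ρ hρ).trans ?_
      calc _ ≤ C₁ * ENNReal.ofReal ρ ^ e * (A * ENNReal.ofReal ρ ^ s) := by gcongr; exact h ρ hρ
        _ = _ := by rw [ofReal_rpow_add hρ]; ring) δ hδ
  rw [withDensity_apply _ measurableSet_ball.compl] at this
  refine this.trans (le_of_eq ?_)
  push_cast; ring

/-- The maximal function at `x` controls the mass of `g` in balls about `x`, which is the annular
hypothesis with `s = n`. -/
lemma exists_lintegral_ball_kernel_le_maxFn (hn : 0 < n) {a : ℝ} (ha : 0 < a) :
    ∃ C : ℝ≥0, ∀ (g : E n → ℝ≥0∞) (x : E n) (δ : ℝ), 0 < δ →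
      ∫⁻ y in ball x δ, g y * ENNReal.ofReal ‖x - y‖ ^ (a - n) ≤
        C * (maxFn g x * ENNReal.ofReal δ ^ a) := by
  obtain ⟨C, hC⟩ := exists_lintegral_ball_kernel_le hn (s := n) (e := a - n) (by linarith)
  refine ⟨C * 2 ^ n, fun g x δ hδ => ?_⟩
  refine (hC g x (2 ^ n * maxFn g x) (fun ρ hρ => ?_) δ hδ).trans (le_of_eq ?_)
  · refine (lintegral_mono_set sdiff_subset).trans
      ((lintegral_ball_le_maxFn g (mem_ball_self (by positivity))).trans (le_of_eq ?_))
    rw [ENNReal.ofReal_mul (by norm_num), ENNReal.mul_rpow_of_nonneg _ _ (by positivity),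
      ENNReal.ofReal_ofNat, ENNReal.rpow_natCast]
    ring
  · rw [add_sub_cancel]; push_cast; ring

/-- Hölder gives the annular hypothesis with `s = n (1 - 1/p)`; then `s + (a - n) = a - n/p`, whose
negativity makes the outward series converge. -/
lemma exists_lintegral_compl_ball_kernel_le_rpow {p a : ℝ} (hp : 1 ≤ p) (ha : a - n / p < 0) :
    ∃ C : ℝ≥0, ∀ (g : E n → ℝ≥0∞), AEMeasurable g → ∀ (x : E n) (δ : ℝ), 0 < δ →
      ∫⁻ y in (ball x δ)ᶜ, g y * ENNReal.ofReal ‖x - y‖ ^ (a - n) ≤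
        C * ((∫⁻ y, g y ^ p) ^ (1 / p) * ENNReal.ofReal δ ^ (a - n / p)) := by
  have hp0 : 0 < p := by linarith
  have hp1 : 0 ≤ 1 - 1 / p := by
    rw [sub_nonneg, div_le_one hp0]; exact hp
  obtain ⟨C, hC⟩ := exists_lintegral_compl_ball_kernel_le (n := n) (s := n * (1 - 1 / p))
    (e := a - n) (by ring_nf; ring_nf at ha; linarith)
  set K : ℝ≥0∞ := (2 ^ (n : ℝ) * unitVol n) ^ (1 - 1 / p) with hK
  have hKt : K ≠ ⊤ := ENNReal.rpow_ne_top_of_nonneg hp1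
    (ENNReal.mul_ne_top (by simp) unitVol_ne_top)
  refine ⟨C * K.toNNReal, fun g hg x δ hδ => ?_⟩
  refine (hC g x ((∫⁻ y, g y ^ p) ^ (1 / p) * K) (fun ρ hρ => ?_) δ hδ).trans (le_of_eq ?_)
  · refine (lintegral_mono_set sdiff_subset).trans
      ((lintegral_le_rpow_mul_volume hp hg).trans ?_)
    rw [volume_ball_eq _ (by positivity), mul_assoc]
    gcongr
    · exact Measure.restrict_le_self
    · have h2 : ENNReal.ofReal (2 * ρ) ^ (n : ℝ) = 2 ^ (n : ℝ) * ENNReal.ofReal ρ ^ (n : ℝ) := by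
        rw [ENNReal.ofReal_mul (by norm_num), ENNReal.mul_rpow_of_nonneg _ _ (by positivity),
          ENNReal.ofReal_ofNat]
      rw [hK, h2, ENNReal.rpow_mul, ← ENNReal.mul_rpow_of_nonneg _ _ hp1, mul_right_comm]
  · rw [ENNReal.coe_mul, ENNReal.coe_toNNReal hKt,
      show n * (1 - 1 / p) + (a - n) = a - n / p by ring]
    ring

lemma ae_eq_zero_of_maxFn_eq_zero {g : E n → ℝ≥0∞} (hg : AEMeasurable g) {x : E n}
    (h : maxFn g x = 0) : g =ᵐ[volume] 0 := by
  rw [← lintegral_eq_zero_iff' hg, ← setLIntegral_univ, ← iUnion_ball_nat x]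
  refine le_antisymm ((lintegral_iUnion_le _ _).trans (le_of_eq ?_)) (zero_le)
  refine ENNReal.tsum_eq_zero.2 fun k => ?_
  rcases Nat.eq_zero_or_pos k with rfl | hk
  · simp
  have := lintegral_ball_le_maxFn g (mem_ball_self (x := x) (ε := k) (by exact_mod_cast hk))
  simpa [h] using this

/-- The two terms of Hedberg's estimate at the optimal radius, with `θ = p/q`. -/
lemma real_mul_rpow_balance {a b θ : ℝ} (ha : 0 < a) (hb : 0 < b) :
    a * (b / a) ^ (1 - θ) = a ^ θ * b ^ (1 - θ) ∧ b * (b / a) ^ (-θ) = a ^ θ * b ^ (1 - θ) := by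
  constructor
  · rw [Real.div_rpow hb.le ha.le, Real.rpow_sub ha, Real.rpow_one]
    field_simp
  · rw [Real.div_rpow hb.le ha.le, Real.rpow_sub hb, Real.rpow_one, Real.rpow_neg ha.le,
      Real.rpow_neg hb.le]
    field_simp

/-- Hedberg's inequality. -/
lemma exists_lintegral_kernel_le_maxFn_rpow (hn : 0 < n) {p q γ : ℝ} (hp : 1 ≤ p) (hγ : 0 < γ)
    (hq0 : 0 < q) (hq : 1 / p - 1 / q = γ / n) :
    ∃ C : ℝ≥0, ∀ (g : E n → ℝ≥0∞), AEMeasurable g → ∫⁻ y, g y ^ p ≠ ⊤ → ∀ x : E n,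
      ∫⁻ y, g y * ENNReal.ofReal ‖x - y‖ ^ (γ - n) ≤
        C * (maxFn g x ^ (p / q) * ((∫⁻ y, g y ^ p) ^ (1 / p)) ^ (1 - p / q)) := by
  have hp0 : 0 < p := by linarith
  have hn' : (0 : ℝ) < n := by exact_mod_cast hn
  have hγ' : γ - n / p = -(n / q) := by
    field_simp at hq ⊢; linarith
  obtain ⟨C₁, hC₁⟩ := exists_lintegral_ball_kernel_le_maxFn (n := n) hn hγ
  obtain ⟨C₂, hC₂⟩ := exists_lintegral_compl_ball_kernel_le_rpow (n := n) (a := γ) hp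
    (by rw [hγ']; have := div_pos hn' hq0; linarith)
  -- The summand `1` keeps the constant nonzero, so that the right side is `⊤` when the maximal
  -- function is.
  refine ⟨C₁ + C₂ + 1, fun g hg hF x => ?_⟩
  set F := (∫⁻ y, g y ^ p) ^ (1 / p) with hFdef
  have hFt : F ≠ ⊤ := ENNReal.rpow_ne_top_of_nonneg (by positivity) hF
  set u := maxFn g x with hu
  have hzero : g =ᵐ[volume] 0 → ∫⁻ y, g y * ENNReal.ofReal ‖x - y‖ ^ (γ - n) = 0 := fun h => by
    rw [lintegral_congr_ae (g := fun _ => 0) (h.mono fun y hy => by simp [hy])]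
    simp
  rcases eq_or_ne u 0 with hu0 | hu0
  · rw [hzero (ae_eq_zero_of_maxFn_eq_zero hg hu0)]; exact zero_le
  rcases eq_or_ne F 0 with hF0 | hF0
  · rw [hzero]
    · exact zero_le
    · rw [hFdef, ENNReal.rpow_eq_zero_iff_of_pos (by positivity),
        lintegral_eq_zero_iff' (hg.pow_const p)] at hF0
      filter_upwards [hF0] with y hy
      simpa [ENNReal.rpow_eq_zero_iff_of_pos hp0] using hy
  rcases eq_or_ne u ⊤ with hut | hut
  · rw [hut, ENNReal.top_rpow_of_pos (by positivity), ENNReal.top_mul, ENNReal.mul_top]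
    · exact le_top
    · simp
    · simp [ENNReal.rpow_eq_zero_iff, hF0, hFt]
  set a := u.toReal
  set b := F.toReal
  have ha : 0 < a := ENNReal.toReal_pos hu0 hut
  have hb : 0 < b := ENNReal.toReal_pos hF0 hFt
  have hua : u = ENNReal.ofReal a := (ENNReal.ofReal_toReal hut).symm
  have hFb : F = ENNReal.ofReal b := (ENNReal.ofReal_toReal hFt).symm
  obtain ⟨e1, e2⟩ := real_mul_rpow_balance (θ := p / q) ha hb
  -- This radius balances the near part `u δ ^ γ` with the far part `F δ ^ (γ - n/p)`.
  set δ := (b / a) ^ (p / n) with hδ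
  have hδ0 : 0 < δ := by positivity
  have hRHS : u ^ (p / q) * F ^ (1 - p / q) = ENNReal.ofReal (a ^ (p / q) * b ^ (1 - p / q)) := by
    rw [hua, hFb, ENNReal.ofReal_rpow_of_pos ha, ENNReal.ofReal_rpow_of_pos hb,
      ← ENNReal.ofReal_mul (by positivity)]
  have h1 : u * ENNReal.ofReal δ ^ γ = u ^ (p / q) * F ^ (1 - p / q) := by
    rw [hRHS, hua, ENNReal.ofReal_rpow_of_pos hδ0, ← ENNReal.ofReal_mul ha.le, hδ,
      ← Real.rpow_mul (by positivity), show p / n * γ = 1 - p / q by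
        field_simp at hq ⊢; linarith, e1]
  have h2 : F * ENNReal.ofReal δ ^ (γ - n / p) = u ^ (p / q) * F ^ (1 - p / q) := by
    rw [hRHS, hFb, ENNReal.ofReal_rpow_of_pos hδ0, ← ENNReal.ofReal_mul hb.le, hδ,
      ← Real.rpow_mul (by positivity), hγ', show p / n * -(n / q) = -(p / q) by
        field_simp, e2]
  rw [← lintegral_add_compl _ (measurableSet_ball (x := x) (ε := δ))]
  calc _ ≤ C₁ * (u * ENNReal.ofReal δ ^ γ) + C₂ * (F * ENNReal.ofReal δ ^ (γ - n / p)) :=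
        add_le_add (hC₁ g x δ hδ0) (hC₂ g hg x δ hδ0)
    _ = (C₁ + C₂) * (u ^ (p / q) * F ^ (1 - p / q)) := by rw [h1, h2]; ring
    _ ≤ _ := by
      gcongr
      push_cast
      exact le_self_add

/-- On `B(x, ρ)` the kernel of order `α` is at most `ρ ^ (α - γ)` times that of order `γ`, to which
Hedberg's inequality applies. For `γ = 0` one has `p = q`, and the near estimate of order `α > 0` by
the maximal function suffices. -/
lemma exists_lintegral_ball_kernel_le_maxFn_rpow (hn : 0 < n) {p q α γ : ℝ} (hp : 1 ≤ p)
    (hα : 0 < α) (hγ : 0 ≤ γ) (hγα : γ ≤ α) (hq0 : 0 < q) (hq : 1 / p - 1 / q = γ / n) :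
    ∃ C : ℝ≥0, ∀ (g : E n → ℝ≥0∞), AEMeasurable g → ∫⁻ y, g y ^ p ≠ ⊤ →
      ∀ (x : E n) (ρ : ℝ), 0 < ρ →
      ∫⁻ y in ball x ρ, g y * ENNReal.ofReal ‖x - y‖ ^ (α - n) ≤
        C * (ENNReal.ofReal ρ ^ (α - γ) *
          (maxFn g x ^ (p / q) * ((∫⁻ y, g y ^ p) ^ (1 / p)) ^ (1 - p / q))) := by
  have hp0 : 0 < p := by linarith
  rcases hγ.eq_or_lt with rfl | hγ
  · have hpq : p = q := by
      rw [zero_div, sub_eq_zero] at hq; field_simp at hq; exact hq.symm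
    obtain ⟨C, hC⟩ := exists_lintegral_ball_kernel_le_maxFn (n := n) hn hα
    refine ⟨C, fun g hg hF x ρ hρ => (hC g x ρ hρ).trans (le_of_eq ?_)⟩
    rw [← hpq, div_self hp0.ne', sub_self, ENNReal.rpow_one, ENNReal.rpow_zero, mul_one, sub_zero,
      mul_comm (maxFn g x)]
  · obtain ⟨C, hC⟩ := exists_lintegral_kernel_le_maxFn_rpow (n := n) hn hp hγ hq0 hq
    refine ⟨C, fun g hg hF x ρ hρ => ?_⟩
    calc ∫⁻ y in ball x ρ, g y * ENNReal.ofReal ‖x - y‖ ^ (α - n)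
        ≤ ∫⁻ y in ball x ρ, ENNReal.ofReal ρ ^ (α - γ) *
            (g y * ENNReal.ofReal ‖x - y‖ ^ (γ - n)) := by
          refine lintegral_mono_ae ?_
          filter_upwards [ae_restrict_mem measurableSet_ball,
            ae_restrict_of_ae (measure_eq_zero_iff_ae_notMem.1 (volume_singleton_eq_zero hn x))]
            with y hy hne
          have hxy : 0 < ‖x - y‖ := norm_pos_iff.2 (sub_ne_zero.2 (Ne.symm hne))
          rw [show α - n = (α - γ) + (γ - n) by ring, ofReal_rpow_add hxy]
          calc _ = ENNReal.ofReal ‖x - y‖ ^ (α - γ) *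
                (g y * ENNReal.ofReal ‖x - y‖ ^ (γ - n)) := by ring
            _ ≤ _ := by
              gcongr
              rw [← dist_eq_norm, dist_comm]
              exact (mem_ball.1 hy).le
      _ = ENNReal.ofReal ρ ^ (α - γ) *
            ∫⁻ y in ball x ρ, g y * ENNReal.ofReal ‖x - y‖ ^ (γ - n) :=
          lintegral_const_mul' _ _ (ofReal_rpow_ne_top hρ _)
      _ ≤ ENNReal.ofReal ρ ^ (α - γ) * (C * _) := by
          gcongr
          exact (lintegral_mono' Measure.restrict_le_self le_rfl).trans (hC g hg hF x)
      _ = _ := by ring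

/-! ### Pointwise bounds by a power and a local part -/

/-- The part of `∫ g(y) |x - y| ^ (α - n) dy` over the ball `B(x, |x| / 2)`. -/
noncomputable def localInt (α : ℝ) (g : E n → ℝ≥0∞) (x : E n) : ℝ≥0∞ :=
  ∫⁻ y in ball x (‖x‖ / 2), g y * ENNReal.ofReal ‖x - y‖ ^ (α - n)

/-- The `L^p` norms of `g` over dyadic annuli are at most those of `N |x| ^ (-d)`,
up to constants. -/
def DyadicBound (p d : ℝ) (g : E n → ℝ≥0∞) (N : ℝ≥0∞) : Prop :=
  ∀ ρ : ℝ, 0 < ρ → ∫⁻ y in ball 0 (4 * ρ) \ ball 0 (ρ / 2), g y ^ p ≤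
    N ^ p * ENNReal.ofReal ρ ^ (n - p * d)

lemma ofReal_mul_rpow {c ρ : ℝ} (hc : 0 < c) (s : ℝ) :
    ENNReal.ofReal (c * ρ) ^ s = ENNReal.ofReal c ^ s * ENNReal.ofReal ρ ^ s := by
  rw [ENNReal.ofReal_mul hc.le, ENNReal.mul_rpow_of_ne_top (by simp) (by simp)]

lemma rpow_le_rpow_of_nonpos' {a b : ℝ≥0∞} (h : a ≤ b) {e : ℝ} (he : e ≤ 0) : b ^ e ≤ a ^ e := by
  rw [← neg_neg e, ENNReal.rpow_neg, ENNReal.rpow_neg a]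
  exact ENNReal.inv_le_inv.2 (ENNReal.rpow_le_rpow h (by linarith))

lemma DyadicBound.rpow_lintegral_le {p d : ℝ} (hp : 1 ≤ p) {g : E n → ℝ≥0∞} {N : ℝ≥0∞}
    (h : DyadicBound p d g N) {ρ : ℝ} (hρ : 0 < ρ) :
    (∫⁻ y in ball 0 (4 * ρ) \ ball 0 (ρ / 2), g y ^ p) ^ (1 / p) ≤
      N * ENNReal.ofReal ρ ^ (n / p - d) := by
  have hp0 : 0 < p := by linarith
  calc _ ≤ (N ^ p * ENNReal.ofReal ρ ^ (n - p * d)) ^ (1 / p) := by gcongr; exact h ρ hρ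
    _ = _ := by
      rw [ENNReal.mul_rpow_of_nonneg _ _ (by positivity), ← ENNReal.rpow_mul, ← ENNReal.rpow_mul,
        mul_one_div_cancel hp0.ne', ENNReal.rpow_one]
      congr 2
      field_simp

lemma annulus_subset {ρ : ℝ} (hρ : 0 < ρ) :
    ball (0 : E n) (2 * ρ) \ ball 0 ρ ⊆ ball 0 (4 * ρ) \ ball 0 (ρ / 2) :=
  sdiff_subset_sdiff (ball_subset_ball (by linarith)) (ball_subset_ball (by linarith))

lemma exists_lintegral_annulus_le {p : ℝ} (hp : 1 ≤ p) (d : ℝ) :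
    ∃ C : ℝ≥0, ∀ (g : E n → ℝ≥0∞) (N : ℝ≥0∞), AEMeasurable g → DyadicBound p d g N →
      ∀ ρ : ℝ, 0 < ρ → ∫⁻ y in ball 0 (2 * ρ) \ ball 0 ρ, g y ≤
        C * N * ENNReal.ofReal ρ ^ (n - d) := by
  have hp0 : 0 < p := by linarith
  have hp1 : 0 ≤ 1 - 1 / p := by
    rw [sub_nonneg, div_le_one hp0]; exact hp
  set K : ℝ≥0∞ := (ENNReal.ofReal 4 ^ (n : ℝ) * unitVol n) ^ (1 - 1 / p) with hK
  have hKt : K ≠ ⊤ := ENNReal.rpow_ne_top_of_nonneg hp1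
    (ENNReal.mul_ne_top (by simp) unitVol_ne_top)
  refine ⟨K.toNNReal, fun g N hg h ρ hρ => ?_⟩
  rw [ENNReal.coe_toNNReal hKt]
  calc _ ≤ ∫⁻ y in ball 0 (4 * ρ) \ ball 0 (ρ / 2), g y := lintegral_mono_set (annulus_subset hρ)
    _ ≤ _ := lintegral_le_rpow_mul_volume hp hg
    _ ≤ N * ENNReal.ofReal ρ ^ (n / p - d) * (K * ENNReal.ofReal ρ ^ (n * (1 - 1 / p))) := by
      gcongr ?_ * ?_
      · exact h.rpow_lintegral_le hp hρ
      · calc _ ≤ volume (ball (0 : E n) (4 * ρ)) ^ (1 - 1 / p) := by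
              gcongr; exact sdiff_subset
          _ = _ := by
            rw [volume_ball_eq _ (by positivity), ofReal_mul_rpow (by norm_num), hK,
              ENNReal.rpow_mul, ← ENNReal.mul_rpow_of_nonneg _ _ hp1, mul_right_comm]
    _ = K * N * (ENNReal.ofReal ρ ^ (n / p - d) * ENNReal.ofReal ρ ^ (n * (1 - 1 / p))) := by ring
    _ = _ := by
      rw [← ofReal_rpow_add hρ]
      congr 2
      ring

/-- By Hölder the annular masses are of order `ρ ^ (n - d)`; this is where `d < n` is needed. It
also yields the local integrability of `f`. -/
lemma exists_lintegral_ball_le (hn : 0 < n) {p d : ℝ} (hp : 1 ≤ p) (hd : d < n) :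
    ∃ C : ℝ≥0, ∀ (g : E n → ℝ≥0∞) (N : ℝ≥0∞), AEMeasurable g → DyadicBound p d g N →
      ∀ ρ : ℝ, 0 < ρ → ∫⁻ y in ball 0 ρ, g y ≤ C * N * ENNReal.ofReal ρ ^ (n - d) := by
  obtain ⟨C₁, hC₁⟩ := exists_lintegral_annulus_le (n := n) hp d
  obtain ⟨C₂, hC₂⟩ := exists_lintegral_ball_kernel_le hn (s := n - d) (e := 0) (by linarith)
  refine ⟨C₂ * C₁, fun g N hg h ρ hρ => ?_⟩
  have := hC₂ g 0 (C₁ * N) (hC₁ g N hg h) ρ hρ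
  simp only [ENNReal.rpow_zero, mul_one, add_zero] at this
  refine this.trans (le_of_eq ?_)
  push_cast; ring

/-- With the kernel the annular masses are of order `ρ ^ (α - d)`; their sum to infinity needs the
strict inequality `α < d`. -/
lemma exists_lintegral_compl_ball_le {p d α : ℝ} (hp : 1 ≤ p) (hd : α < d) :
    ∃ C : ℝ≥0, ∀ (g : E n → ℝ≥0∞) (N : ℝ≥0∞), AEMeasurable g → DyadicBound p d g N →
      ∀ ρ : ℝ, 0 < ρ → ∫⁻ y in (ball 0 ρ)ᶜ, g y * ENNReal.ofReal ‖y‖ ^ (α - n) ≤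
        C * N * ENNReal.ofReal ρ ^ (α - d) := by
  obtain ⟨C₁, hC₁⟩ := exists_lintegral_annulus_le (n := n) hp d
  obtain ⟨C₂, hC₂⟩ := exists_lintegral_compl_ball_kernel_le (n := n) (s := n - d) (e := α - n)
    (by linarith)
  refine ⟨C₂ * C₁, fun g N hg h ρ hρ => ?_⟩
  have := hC₂ g 0 (C₁ * N) (hC₁ g N hg h) ρ hρ
  simp only [zero_sub, norm_neg] at this
  refine this.trans (le_of_eq ?_)
  rw [show (n : ℝ) - d + (α - n) = α - d by ring]
  push_cast; ring

/-- The fractional integral of `g` is controlled by its local part and a power. -/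
lemma exists_lintegral_kernel_le (hn : 0 < n) {p d α : ℝ} (hp : 1 ≤ p)
    (hd : α < d) (hdn : d < n) :
    ∃ C : ℝ≥0, ∀ (g : E n → ℝ≥0∞) (N : ℝ≥0∞), AEMeasurable g → DyadicBound p d g N →
      ∀ x : E n, x ≠ 0 → ∫⁻ y, g y * ENNReal.ofReal ‖x - y‖ ^ (α - n) ≤
        C * (N * ENNReal.ofReal ‖x‖ ^ (α - d) + localInt α g x) := by
  obtain ⟨C₁, hC₁⟩ := exists_lintegral_ball_le hn hp hdn
  obtain ⟨C₂, hC₂⟩ := exists_lintegral_compl_ball_le (n := n) hp hd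
  obtain ⟨C₃, -, hC₃⟩ := exists_rpow_le_of_comparable (α - n)
  have he : α - n ≤ 0 := by linarith
  refine ⟨1 + C₃ * C₁ + C₃ * C₂, fun g N hg h x hx => ?_⟩
  have hx0 : 0 < ‖x‖ := norm_pos_iff.2 hx
  have hfar : ∀ y ∉ ball x (‖x‖ / 2), ‖x‖ / 2 ≤ ‖x - y‖ := fun y hy => by
    rw [mem_ball, not_lt, dist_comm, dist_eq_norm] at hy; exact hy
  have hcover : (univ : Set (E n)) ⊆ ball x (‖x‖ / 2) ∪
      ((ball 0 ‖x‖ \ ball x (‖x‖ / 2)) ∪ ((ball 0 ‖x‖)ᶜ \ ball x (‖x‖ / 2))) := by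
    intro y _
    by_cases h1 : y ∈ ball x (‖x‖ / 2)
    · exact .inl h1
    · by_cases h2 : y ∈ ball (0 : E n) ‖x‖
      · exact .inr (.inl ⟨h2, h1⟩)
      · exact .inr (.inr ⟨h2, h1⟩)
  have hnear : ∫⁻ y in ball 0 ‖x‖ \ ball x (‖x‖ / 2), g y * ENNReal.ofReal ‖x - y‖ ^ (α - n) ≤
      C₃ * C₁ * (N * ENNReal.ofReal ‖x‖ ^ (α - d)) := by
    calc _ ≤ ∫⁻ y in ball 0 ‖x‖ \ ball x (‖x‖ / 2),
            C₃ * ENNReal.ofReal ‖x‖ ^ (α - n) * g y := by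
          refine setLIntegral_mono' (measurableSet_ball.diff measurableSet_ball) fun y hy => ?_
          rw [mul_comm]
          gcongr
          exact (rpow_le_rpow_of_nonpos' (ENNReal.ofReal_le_ofReal (hfar y hy.2)) he).trans
            (hC₃ _ _ hx0 (by linarith) (by linarith))
      _ = C₃ * ENNReal.ofReal ‖x‖ ^ (α - n) * ∫⁻ y in ball 0 ‖x‖ \ ball x (‖x‖ / 2), g y :=
          lintegral_const_mul' _ _ (ENNReal.mul_ne_top (by simp) (ofReal_rpow_ne_top hx0 _))
      _ ≤ C₃ * ENNReal.ofReal ‖x‖ ^ (α - n) * (C₁ * N * ENNReal.ofReal ‖x‖ ^ (n - d)) := by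
          gcongr
          exact (lintegral_mono_set sdiff_subset).trans (hC₁ g N hg h _ hx0)
      _ = C₃ * C₁ * (N * (ENNReal.ofReal ‖x‖ ^ (α - n) * ENNReal.ofReal ‖x‖ ^ (n - d))) := by ring
      _ = _ := by rw [← ofReal_rpow_add hx0]; congr 3; ring
  -- Away from `B(x, |x|/2)` one has `|y| ≤ |x| + |x - y| ≤ 3 |x - y|`, so the kernel is at most a
  -- multiple of `|y| ^ (α - n)`.
  have hout : ∫⁻ y in (ball 0 ‖x‖)ᶜ \ ball x (‖x‖ / 2), g y * ENNReal.ofReal ‖x - y‖ ^ (α - n) ≤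
      C₃ * C₂ * (N * ENNReal.ofReal ‖x‖ ^ (α - d)) := by
    calc _ ≤ ∫⁻ y in (ball 0 ‖x‖)ᶜ \ ball x (‖x‖ / 2),
            C₃ * (g y * ENNReal.ofReal ‖y‖ ^ (α - n)) := by
          refine setLIntegral_mono' (measurableSet_ball.compl.diff measurableSet_ball)
            fun y hy => ?_
          have hy1 : ‖x‖ ≤ ‖y‖ := by simpa using hy.1
          have hy2 := hfar y hy.2
          have hy3 : ‖y‖ ≤ ‖x‖ + ‖x - y‖ := by
            simpa [norm_sub_rev] using norm_le_norm_add_norm_sub x y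
          calc _ ≤ g y * (C₃ * ENNReal.ofReal ‖y‖ ^ (α - n)) := by
                gcongr
                exact (rpow_le_rpow_of_nonpos' (ENNReal.ofReal_le_ofReal
                  (by linarith : ‖y‖ / 4 ≤ ‖x - y‖)) he).trans
                  (hC₃ _ _ (by linarith) (by linarith) (by linarith))
            _ = _ := by ring
      _ = C₃ * ∫⁻ y in (ball 0 ‖x‖)ᶜ \ ball x (‖x‖ / 2), g y * ENNReal.ofReal ‖y‖ ^ (α - n) :=
          lintegral_const_mul' _ _ (by simp)
      _ ≤ C₃ * (C₂ * N * ENNReal.ofReal ‖x‖ ^ (α - d)) := by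
          gcongr
          exact (lintegral_mono_set sdiff_subset).trans (hC₂ g N hg h _ hx0)
      _ = _ := by ring
  rw [← setLIntegral_univ]
  calc _ ≤ localInt α g x + (C₃ * C₁ * (N * ENNReal.ofReal ‖x‖ ^ (α - d)) +
          C₃ * C₂ * (N * ENNReal.ofReal ‖x‖ ^ (α - d))) :=
        (lintegral_mono_set hcover).trans ((lintegral_union_le _ _ _).trans
          (add_le_add le_rfl ((lintegral_union_le _ _ _).trans (add_le_add hnear hout))))
    _ ≤ localInt α g x + (C₃ * C₁ * (N * ENNReal.ofReal ‖x‖ ^ (α - d)) +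
          C₃ * C₂ * (N * ENNReal.ofReal ‖x‖ ^ (α - d))) +
          (N * ENNReal.ofReal ‖x‖ ^ (α - d) + (C₃ * C₁ + C₃ * C₂) * localInt α g x) := le_self_add
    _ = _ := by push_cast; ring

lemma one_sub_div_nonneg (hn : 0 < n) {α : ℝ} (hαn : α < n) : 0 ≤ 1 - α / n := by
  have hn' : (0 : ℝ) < n := by exact_mod_cast hn
  rw [sub_nonneg, div_le_one hn']; exact hαn.le

lemma volume_ball_rpow (hn : 0 < n) {α : ℝ} (hαn : α < n) (c : E n) {r : ℝ} (hr : 0 < r) :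
    volume (ball c r) ^ (1 - α / n) =
      ENNReal.ofReal r ^ (n - α) * unitVol n ^ (1 - α / n) := by
  have hn' : (0 : ℝ) < n := by exact_mod_cast hn
  rw [volume_ball_eq _ hr, ENNReal.mul_rpow_of_nonneg _ _ (one_sub_div_nonneg hn hαn),
    ← ENNReal.rpow_mul]
  congr 2
  field_simp

lemma unitVol_rpow_ne_zero (s : ℝ) : unitVol n ^ s ≠ 0 := by
  simp [ENNReal.rpow_eq_zero_iff, unitVol_ne_zero, unitVol_ne_top]

lemma unitVol_rpow_ne_top (s : ℝ) : unitVol n ^ s ≠ ⊤ := by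
  simp [ENNReal.rpow_eq_top_iff, unitVol_ne_zero, unitVol_ne_top]

lemma div_volume_ball_rpow (hn : 0 < n) {α : ℝ} (hαn : α < n) (a : ℝ≥0∞) (c : E n) {r : ℝ}
    (hr : 0 < r) :
    a / volume (ball c r) ^ (1 - α / n) =
      (unitVol n ^ (1 - α / n))⁻¹ * (a * ENNReal.ofReal r ^ (α - n)) := by
  rw [volume_ball_rpow hn hαn _ hr, ENNReal.div_eq_inv_mul,
    ENNReal.mul_inv (.inr (unitVol_rpow_ne_top _)) (.inr (unitVol_rpow_ne_zero _)),
    ← ENNReal.rpow_neg, neg_sub]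
  ring

/-- The averages defining the fractional maximal function of `g` are controlled by the local part
of the fractional integral and a power. -/
lemma exists_average_le (hn : 0 < n) {p d α : ℝ} (hp : 1 ≤ p) (hαn : α < n)
    (hd : α ≤ d) (hdn : d < n) :
    ∃ C : ℝ≥0, ∀ (g : E n → ℝ≥0∞) (N : ℝ≥0∞), AEMeasurable g → DyadicBound p d g N →
      ∀ x : E n, x ≠ 0 → ∀ (c : E n) (r : ℝ), x ∈ ball c r →
        (∫⁻ y in ball c r, g y) / volume (ball c r) ^ (1 - α / n) ≤
          C * (N * ENNReal.ofReal ‖x‖ ^ (α - d) + localInt α g x) := by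
  obtain ⟨C₁, hC₁⟩ := exists_lintegral_ball_le hn hp hdn
  have he : α - n ≤ 0 := by linarith
  set K₁ : ℝ≥0∞ := C₁ * (ENNReal.ofReal 10 ^ (n - d) * ENNReal.ofReal (1 / 8) ^ (α - d)) with hK₁
  set K₂ : ℝ≥0∞ := ENNReal.ofReal (1 / 2) ^ (α - n) with hK₂
  set W : ℝ≥0∞ := (unitVol n ^ (1 - α / n))⁻¹ with hW
  have hKt : W * (K₁ + K₂) ≠ ⊤ := by
    refine ENNReal.mul_ne_top (ENNReal.inv_ne_top.2 (unitVol_rpow_ne_zero _))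
      (ENNReal.add_ne_top.2 ⟨?_, ofReal_rpow_ne_top (by norm_num) _⟩)
    exact ENNReal.mul_ne_top (by simp) (ENNReal.mul_ne_top
      (ofReal_rpow_ne_top (by norm_num) _) (ofReal_rpow_ne_top (by norm_num) _))
  refine ⟨(W * (K₁ + K₂)).toNNReal, fun g N hg h x hx c r hxc => ?_⟩
  have hx0 : 0 < ‖x‖ := norm_pos_iff.2 hx
  have hr : 0 < r := pos_of_mem_ball hxc
  rw [ENNReal.coe_toNNReal hKt, div_volume_ball_rpow hn hαn _ _ hr, mul_assoc]
  gcongr W * ?_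
  -- A ball with `r ≥ |x|/8` lies in `B(0, 10 r)`, and `r ^ (α - d)` is then dominated by `|x| ^ (α
  -- - d)` because `α - d ≤ 0`. A smaller ball lies in `B(x, 2 r)`, inside `B(x, |x|/2)`, where the
  -- kernel is at least `(2 r) ^ (α - n)`.
  rcases le_or_gt (‖x‖ / 8) r with hxr | hxr
  · have hsub : ball c r ⊆ ball 0 (10 * r) := by
      intro y hy
      rw [mem_ball_zero_iff]
      have h1 : ‖y - x‖ < 2 * r := by
        rw [← dist_eq_norm]
        linarith [dist_triangle_right y x c, mem_ball.1 hy, mem_ball.1 hxc]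
      linarith [norm_le_norm_add_norm_sub x y, norm_sub_rev x y]
    calc _ ≤ C₁ * N * ENNReal.ofReal (10 * r) ^ (n - d) * ENNReal.ofReal r ^ (α - n) := by
          gcongr
          exact (lintegral_mono_set hsub).trans (hC₁ g N hg h _ (by positivity))
      _ = C₁ * ENNReal.ofReal 10 ^ (n - d) * N *
            (ENNReal.ofReal r ^ (n - d) * ENNReal.ofReal r ^ (α - n)) := by
          rw [ofReal_mul_rpow (by norm_num)]; ring
      _ = C₁ * ENNReal.ofReal 10 ^ (n - d) * N * ENNReal.ofReal r ^ (α - d) := by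
          rw [← ofReal_rpow_add hr]; congr 2; ring
      _ ≤ C₁ * ENNReal.ofReal 10 ^ (n - d) * N * ENNReal.ofReal (1 / 8 * ‖x‖) ^ (α - d) := by
          refine mul_le_mul' le_rfl ?_
          exact rpow_le_rpow_of_nonpos' (ENNReal.ofReal_le_ofReal (by linarith)) (by linarith)
      _ = K₁ * (N * ENNReal.ofReal ‖x‖ ^ (α - d)) := by
          rw [ofReal_mul_rpow (by norm_num), hK₁]; ring
      _ ≤ _ := by gcongr; exacts [le_self_add, le_self_add]
  · have hdist : ∀ y ∈ ball c r, ‖x - y‖ < 2 * r := fun y hy => by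
      rw [← dist_eq_norm]
      linarith [dist_triangle_right x y c, mem_ball.1 hy, mem_ball.1 hxc]
    calc _ = K₂ * ((∫⁻ y in ball c r, g y) * ENNReal.ofReal (2 * r) ^ (α - n)) := by
          rw [ofReal_mul_rpow (by norm_num), hK₂]
          have : ENNReal.ofReal (1 / 2) ^ (α - n) * ENNReal.ofReal 2 ^ (α - n) = 1 := by
            rw [← ofReal_mul_rpow (by norm_num)]; norm_num
          rw [show ∀ a b c d : ℝ≥0∞, a * (b * (c * d)) = (a * c) * (b * d) by intros; ring, this,
            one_mul]
      _ = K₂ * ∫⁻ y in ball c r, g y * ENNReal.ofReal (2 * r) ^ (α - n) := by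
          rw [lintegral_mul_const' _ _ (ofReal_rpow_ne_top (by positivity) _)]
      _ ≤ K₂ * ∫⁻ y in ball c r, g y * ENNReal.ofReal ‖x - y‖ ^ (α - n) := by
          gcongr K₂ * ?_
          refine setLIntegral_mono' measurableSet_ball fun y hy => ?_
          refine mul_le_mul' le_rfl ?_
          exact rpow_le_rpow_of_nonpos' (ENNReal.ofReal_le_ofReal (hdist y hy).le) he
      _ ≤ K₂ * localInt α g x := by
          gcongr
          refine lintegral_mono_set fun y hy => ?_
          rw [mem_ball, dist_comm, dist_eq_norm]
          linarith [hdist y hy]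
      _ ≤ _ := by gcongr; exacts [le_add_self, le_add_self]

/-! ### Strong and weak bounds on a single annulus -/

lemma le_of_one_div_sub_eq {p q γ : ℝ} (hp : 1 ≤ p) (hγ : 0 ≤ γ) (hq0 : 0 < q)
    (hq : 1 / p - 1 / q = γ / n) : p ≤ q := by
  have h : 1 / q ≤ 1 / p := by
    have : 0 ≤ γ / n := by positivity
    linarith
  exact (one_div_le_one_div hq0 (by linarith)).1 h

/-- The restriction of `g` to a neighborhood of the dyadic annulus of radius `ρ`. -/
noncomputable def annulusPart (g : E n → ℝ≥0∞) (ρ : ℝ) : E n → ℝ≥0∞ :=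
  (ball 0 (4 * ρ) \ ball 0 (ρ / 2)).indicator g

lemma aemeasurable_annulusPart {g : E n → ℝ≥0∞} (hg : AEMeasurable g) (ρ : ℝ) :
    AEMeasurable (annulusPart g ρ) :=
  hg.indicator (measurableSet_ball.diff measurableSet_ball)

lemma lintegral_annulusPart_rpow {p : ℝ} (hp : 0 < p) (g : E n → ℝ≥0∞) (ρ : ℝ) :
    ∫⁻ y, annulusPart g ρ y ^ p = ∫⁻ y in ball 0 (4 * ρ) \ ball 0 (ρ / 2), g y ^ p := by
  rw [← lintegral_indicator (measurableSet_ball.diff measurableSet_ball)]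
  refine lintegral_congr fun y => ?_
  simp only [annulusPart, indicator]
  split_ifs <;> simp [hp]

/-- For `ρ ≤ |x| < 2 ρ` the ball `B(x, |x|/2)` lies where `ρ/2 ≤ |y| < 4 ρ`, so `g` may be cut off
there before Hedberg's inequality is used. The powers of `ρ` combine to `ρ ^ α` because `(n/p) (1 -
p/q) = γ`. -/
lemma exists_localInt_le (hn : 0 < n) {p q α γ : ℝ} (d : ℝ) (hp : 1 ≤ p)
    (hα : 0 < α) (hγ : 0 ≤ γ) (hγα : γ ≤ α) (hq0 : 0 < q) (hq : 1 / p - 1 / q = γ / n) :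
    ∃ C : ℝ≥0, ∀ (g : E n → ℝ≥0∞) (N : ℝ≥0∞), AEMeasurable g → N ≠ ⊤ → DyadicBound p d g N →
      ∀ ρ : ℝ, 0 < ρ → ∀ x ∈ ball 0 (2 * ρ) \ ball 0 ρ, localInt α g x ≤
        C * (ENNReal.ofReal ρ ^ α * (maxFn (annulusPart g ρ) x ^ (p / q) *
          (N * ENNReal.ofReal ρ ^ (-d)) ^ (1 - p / q))) := by
  have hp0 : 0 < p := by linarith
  have hn' : (0 : ℝ) < n := by exact_mod_cast hn
  have hθ : 0 ≤ 1 - p / q := by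
    rw [sub_nonneg, div_le_one hq0]; exact le_of_one_div_sub_eq hp hγ hq0 hq
  obtain ⟨C, hC⟩ := exists_lintegral_ball_kernel_le_maxFn_rpow (n := n) hn hp hα hγ hγα hq0 hq
  refine ⟨C, fun g N hg hN h ρ hρ x hx => ?_⟩
  have hx1 : ‖x‖ < 2 * ρ := by simpa using hx.1
  have hx2 : ρ ≤ ‖x‖ := by simpa using hx.2
  have hF : ∫⁻ y, annulusPart g ρ y ^ p ≠ ⊤ := by
    rw [lintegral_annulusPart_rpow hp0]
    exact ne_top_of_le_ne_top (ENNReal.mul_ne_top (ENNReal.rpow_ne_top_of_nonneg hp0.le hN)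
      (ofReal_rpow_ne_top hρ _)) (h ρ hρ)
  have hloc : localInt α g x ≤
      ∫⁻ y in ball x ρ, annulusPart g ρ y * ENNReal.ofReal ‖x - y‖ ^ (α - n) := by
    calc localInt α g x = ∫⁻ y in ball x (‖x‖ / 2),
          annulusPart g ρ y * ENNReal.ofReal ‖x - y‖ ^ (α - n) := by
          refine setLIntegral_congr_fun measurableSet_ball fun y hy => ?_
          rw [mem_ball, dist_eq_norm] at hy
          have hmem : y ∈ ball (0 : E n) (4 * ρ) \ ball 0 (ρ / 2) := by
            simp only [mem_sdiff, mem_ball_zero_iff, not_lt]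
            constructor
            · linarith [norm_le_norm_add_norm_sub x y, norm_sub_rev x y]
            · linarith [norm_le_norm_add_norm_sub y x, norm_sub_rev x y]
          simp [annulusPart, indicator_of_mem hmem]
      _ ≤ _ := lintegral_mono_set (ball_subset_ball (by linarith))
  refine hloc.trans ((hC _ (aemeasurable_annulusPart hg ρ) hF x ρ hρ).trans ?_)
  have hFle : (∫⁻ y, annulusPart g ρ y ^ p) ^ (1 / p) ≤
      ENNReal.ofReal ρ ^ (n / p) * (N * ENNReal.ofReal ρ ^ (-d)) := by
    rw [lintegral_annulusPart_rpow hp0]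
    refine (h.rpow_lintegral_le hp hρ).trans (le_of_eq ?_)
    rw [sub_eq_add_neg, ofReal_rpow_add hρ]; ring
  calc _ ≤ C * (ENNReal.ofReal ρ ^ (α - γ) * (maxFn (annulusPart g ρ) x ^ (p / q) *
        (ENNReal.ofReal ρ ^ (n / p) * (N * ENNReal.ofReal ρ ^ (-d))) ^ (1 - p / q))) := by
        gcongr
    _ = C * ((ENNReal.ofReal ρ ^ (α - γ) * ENNReal.ofReal ρ ^ (n / p * (1 - p / q))) *
        (maxFn (annulusPart g ρ) x ^ (p / q) * (N * ENNReal.ofReal ρ ^ (-d)) ^ (1 - p / q))) := by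
        rw [ENNReal.mul_rpow_of_nonneg _ _ hθ, ENNReal.rpow_mul]; ring
    _ = _ := by
        have : n / p * (1 - p / q) = γ := by
          field_simp at hq ⊢; linarith
        rw [← ofReal_rpow_add hρ, this, sub_add_cancel]

/-- With `Λ = N ρ ^ (-d)` the power term is of order `ρ ^ α Λ = ρ ^ α Λ ^ (p/q) Λ ^ (1 - p/q)`, the
form of the local bound with `Λ` in place of the maximal function. Adding `Λ` to the maximal
function thus absorbs it, and one inequality serves the strong and the weak case. -/
lemma exists_rpow_le_maxFn_add (hn : 0 < n) {p q α γ : ℝ} (d : ℝ) (hp : 1 ≤ p)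
    (hα : 0 < α) (hγ : 0 ≤ γ) (hγα : γ ≤ α) (hq0 : 0 < q) (hq : 1 / p - 1 / q = γ / n)
    (C₀ : ℝ≥0) :
    ∃ C : ℝ≥0, ∀ (g : E n → ℝ≥0∞) (N : ℝ≥0∞) (T : E n → ℝ≥0∞), AEMeasurable g → N ≠ ⊤ →
      DyadicBound p d g N →
      (∀ x ≠ 0, T x ≤ C₀ * (N * ENNReal.ofReal ‖x‖ ^ (α - d) + localInt α g x)) →
      ∀ ρ : ℝ, 0 < ρ → ∀ x ∈ ball 0 (2 * ρ) \ ball 0 ρ, T x ^ q ≤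
        C * (ENNReal.ofReal ρ ^ (α * q) * ((N * ENNReal.ofReal ρ ^ (-d)) ^ (q - p) *
          (maxFn (annulusPart g ρ) x + N * ENNReal.ofReal ρ ^ (-d)) ^ p)) := by
  have hp0 : 0 < p := by linarith
  have hpq := le_of_one_div_sub_eq hp hγ hq0 hq
  have hθ : 0 ≤ 1 - p / q := by rwa [sub_nonneg, div_le_one hq0]
  have hθ' : 0 ≤ p / q := by positivity
  obtain ⟨C₁, hC₁⟩ := exists_localInt_le hn d hp hα hγ hγα hq0 hq
  obtain ⟨C₂, -, hC₂⟩ := exists_rpow_le_of_comparable (α - d)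
  refine ⟨(C₀ * (C₂ + C₁)) ^ q, fun g N T hg hN h hT ρ hρ x hx => ?_⟩
  have hx1 : ‖x‖ < 2 * ρ := by simpa using hx.1
  have hx2 : ρ ≤ ‖x‖ := by simpa using hx.2
  set Λ := N * ENNReal.ofReal ρ ^ (-d) with hΛ
  set u := maxFn (annulusPart g ρ) x
  have hpow : N * ENNReal.ofReal ‖x‖ ^ (α - d) ≤
      C₂ * (ENNReal.ofReal ρ ^ α * ((u + Λ) ^ (p / q) * Λ ^ (1 - p / q))) := by
    calc _ ≤ N * (C₂ * ENNReal.ofReal ρ ^ (α - d)) := by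
          gcongr; exact hC₂ _ _ hρ (by linarith) (by linarith)
      _ = C₂ * (ENNReal.ofReal ρ ^ α * Λ) := by
          rw [sub_eq_add_neg, ofReal_rpow_add hρ, hΛ]; ring
      _ = C₂ * (ENNReal.ofReal ρ ^ α * (Λ ^ (p / q) * Λ ^ (1 - p / q))) := by
          rw [← ENNReal.rpow_add_of_nonneg _ _ hθ' hθ, add_sub_cancel, ENNReal.rpow_one]
      _ ≤ _ := by gcongr; exact le_add_self
  have hTx : T x ≤ C₀ * (C₂ + C₁) *
      (ENNReal.ofReal ρ ^ α * ((u + Λ) ^ (p / q) * Λ ^ (1 - p / q))) := by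
    calc T x ≤ _ := hT x (norm_pos_iff.1 (by linarith))
      _ ≤ C₀ * (C₂ * (ENNReal.ofReal ρ ^ α * ((u + Λ) ^ (p / q) * Λ ^ (1 - p / q))) +
          C₁ * (ENNReal.ofReal ρ ^ α * ((u + Λ) ^ (p / q) * Λ ^ (1 - p / q)))) := by
          gcongr
          refine (hC₁ g N hg hN h ρ hρ x hx).trans ?_
          gcongr
          exact le_self_add
      _ = _ := by ring
  calc T x ^ q ≤ (C₀ * (C₂ + C₁) *
      (ENNReal.ofReal ρ ^ α * ((u + Λ) ^ (p / q) * Λ ^ (1 - p / q)))) ^ q := by gcongr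
    _ = _ := by
      rw [ENNReal.mul_rpow_of_nonneg _ _ hq0.le, ENNReal.mul_rpow_of_nonneg _ _ hq0.le,
        ENNReal.mul_rpow_of_nonneg _ _ hq0.le, ENNReal.mul_rpow_of_nonneg _ _ hq0.le,
        ← ENNReal.rpow_mul, ← ENNReal.rpow_mul, ← ENNReal.rpow_mul, div_mul_cancel₀ _ hq0.ne', sub_mul, one_mul,
        div_mul_cancel₀ _ hq0.ne', ENNReal.coe_rpow_of_nonneg _ hq0.le, ENNReal.coe_mul,
        ENNReal.mul_rpow_of_nonneg _ _ hq0.le]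
      push_cast
      ring

lemma lintegral_annulusPart_rpow_le {p d : ℝ} (hp0 : 0 < p) {g : E n → ℝ≥0∞} {N : ℝ≥0∞}
    (h : DyadicBound p d g N) {ρ : ℝ} (hρ : 0 < ρ) :
    ∫⁻ y, annulusPart g ρ y ^ p ≤
      (N * ENNReal.ofReal ρ ^ (-d)) ^ p * ENNReal.ofReal ρ ^ (n : ℝ) := by
  rw [lintegral_annulusPart_rpow hp0]
  refine (h ρ hρ).trans (le_of_eq ?_)
  rw [ENNReal.mul_rpow_of_nonneg _ _ hp0.le, ← ENNReal.rpow_mul, mul_assoc, ← ofReal_rpow_add hρ]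
  congr 2
  ring

lemma volume_annulus_le {ρ : ℝ} (hρ : 0 < ρ) :
    volume (ball (0 : E n) (2 * ρ) \ ball 0 ρ) ≤
      2 ^ n * unitVol n * ENNReal.ofReal ρ ^ (n : ℝ) := by
  refine (measure_mono sdiff_subset).trans (le_of_eq ?_)
  rw [volume_ball_eq _ (by positivity), ofReal_mul_rpow (by norm_num), ENNReal.ofReal_ofNat,
    ENNReal.rpow_natCast]
  ring

lemma mul_rpow_scale {p q α d ρ : ℝ} (hp0 : 0 ≤ p) (hpq : p ≤ q) (hρ : 0 < ρ) (N : ℝ≥0∞) :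
    ENNReal.ofReal ρ ^ (α * q) * ((N * ENNReal.ofReal ρ ^ (-d)) ^ (q - p) *
      ((N * ENNReal.ofReal ρ ^ (-d)) ^ p * ENNReal.ofReal ρ ^ (n : ℝ))) =
      N ^ q * ENNReal.ofReal ρ ^ ((α - d) * q + n) := by
  have hq0 : 0 ≤ q := hp0.trans hpq
  rw [← mul_assoc (_ ^ (q - p)), ← ENNReal.rpow_add_of_nonneg _ _ (by linarith) hp0,
    sub_add_cancel, ENNReal.mul_rpow_of_nonneg _ _ hq0, ← ENNReal.rpow_mul]
  rw [show (α - d) * q + n = α * q + -d * q + n by ring, ofReal_rpow_add hρ, ofReal_rpow_add hρ]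
  ring

/-- Strong type bound on dyadic annuli. -/
lemma exists_lintegral_annulus_rpow_le (hn : 0 < n) {p q α γ : ℝ} (d : ℝ) (hp : 1 < p)
    (hα : 0 < α) (hγ : 0 ≤ γ) (hγα : γ ≤ α) (hq0 : 0 < q) (hq : 1 / p - 1 / q = γ / n)
    (C₀ : ℝ≥0) :
    ∃ C : ℝ≥0, ∀ (g : E n → ℝ≥0∞) (N : ℝ≥0∞) (T : E n → ℝ≥0∞), AEMeasurable g → N ≠ ⊤ →
      DyadicBound p d g N →
      (∀ x ≠ 0, T x ≤ C₀ * (N * ENNReal.ofReal ‖x‖ ^ (α - d) + localInt α g x)) →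
      ∀ ρ : ℝ, 0 < ρ → ∫⁻ x in ball 0 (2 * ρ) \ ball 0 ρ, T x ^ q ≤
        C * (N ^ q * ENNReal.ofReal ρ ^ ((α - d) * q + n)) := by
  have hp0 : 0 < p := by linarith
  have hpq := le_of_one_div_sub_eq hp.le hγ hq0 hq
  obtain ⟨C₁, hC₁⟩ := exists_rpow_le_maxFn_add hn d hp.le hα hγ hγα hq0 hq C₀
  obtain ⟨C₂, hC₂⟩ := exists_lintegral_maxFn_rpow_le hn hp
  -- The factor `2 ^ (p - 1)` splits `(M + Λ) ^ p`; `C₂` bounds the maximal part and `2 ^ n |B(0,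
  -- 1)|` the volume carrying the constant `Λ`.
  set K : ℝ≥0∞ := C₁ * (2 ^ (p - 1) * (C₂ + 2 ^ n * unitVol n)) with hK
  have hKt : K ≠ ⊤ := by
    refine ENNReal.mul_ne_top (by simp) (ENNReal.mul_ne_top (by simp) (ENNReal.add_ne_top.2
      ⟨by simp, ENNReal.mul_ne_top (by simp) unitVol_ne_top⟩))
  refine ⟨K.toNNReal, fun g N T hg hN h hT ρ hρ => ?_⟩
  rw [ENNReal.coe_toNNReal hKt]
  set Λ := N * ENNReal.ofReal ρ ^ (-d) with hΛ
  have hΛt : Λ ≠ ⊤ := ENNReal.mul_ne_top hN (ofReal_rpow_ne_top hρ _)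
  set M := maxFn (annulusPart g ρ)
  have hM : Measurable M := measurable_maxFn _
  calc _ ≤ ∫⁻ x in ball 0 (2 * ρ) \ ball 0 ρ, C₁ * (ENNReal.ofReal ρ ^ (α * q) *
          (Λ ^ (q - p) * (M x + Λ) ^ p)) :=
        setLIntegral_mono' (measurableSet_ball.diff measurableSet_ball) (hC₁ g N T hg hN h hT ρ hρ)
    _ ≤ ∫⁻ x in ball 0 (2 * ρ) \ ball 0 ρ, C₁ * (ENNReal.ofReal ρ ^ (α * q) *
          Λ ^ (q - p)) * 2 ^ (p - 1) * (M x ^ p + Λ ^ p) := by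
        refine lintegral_mono fun x => ?_
        calc _ = C₁ * (ENNReal.ofReal ρ ^ (α * q) * Λ ^ (q - p)) * (M x + Λ) ^ p := by ring
          _ ≤ C₁ * (ENNReal.ofReal ρ ^ (α * q) * Λ ^ (q - p)) *
              (2 ^ (p - 1) * (M x ^ p + Λ ^ p)) := by
            gcongr; exact ENNReal.rpow_add_le_mul_rpow_add_rpow _ _ hp.le
          _ = _ := by ring
    _ = C₁ * (ENNReal.ofReal ρ ^ (α * q) * Λ ^ (q - p)) * 2 ^ (p - 1) *
          ((∫⁻ x in ball 0 (2 * ρ) \ ball 0 ρ, M x ^ p) +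
            Λ ^ p * volume (ball (0 : E n) (2 * ρ) \ ball 0 ρ)) := by
        rw [lintegral_const_mul _ (by fun_prop), lintegral_add_right _ measurable_const,
          setLIntegral_const]
    _ ≤ C₁ * (ENNReal.ofReal ρ ^ (α * q) * Λ ^ (q - p)) * 2 ^ (p - 1) *
          (C₂ * (Λ ^ p * ENNReal.ofReal ρ ^ (n : ℝ)) +
            Λ ^ p * (2 ^ n * unitVol n * ENNReal.ofReal ρ ^ (n : ℝ))) := by
        gcongr
        · exact (setLIntegral_le_lintegral _ _).trans ((hC₂ _ (aemeasurable_annulusPart hg ρ)).trans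
            (by gcongr; exact lintegral_annulusPart_rpow_le hp0 h hρ))
        · exact volume_annulus_le hρ
    _ = K * (ENNReal.ofReal ρ ^ (α * q) * (Λ ^ (q - p) *
          (Λ ^ p * ENNReal.ofReal ρ ^ (n : ℝ)))) := by rw [hK]; ring
    _ = _ := by rw [mul_rpow_scale hp0.le hpq hρ]

/-- Weak type bound on dyadic annuli, for `p = 1`. -/
lemma exists_volume_annulus_le (hn : 0 < n) {q α γ : ℝ} (d : ℝ)
    (hα : 0 < α) (hγ : 0 ≤ γ) (hγα : γ ≤ α) (hq0 : 0 < q) (hq : 1 / 1 - 1 / q = γ / n)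
    (C₀ : ℝ≥0) :
    ∃ C : ℝ≥0, ∀ (g : E n → ℝ≥0∞) (N : ℝ≥0∞) (T : E n → ℝ≥0∞), AEMeasurable g → N ≠ ⊤ →
      DyadicBound 1 d g N →
      (∀ x ≠ 0, T x ≤ C₀ * (N * ENNReal.ofReal ‖x‖ ^ (α - d) + localInt α g x)) →
      ∀ ρ : ℝ, 0 < ρ → ∀ t : ℝ≥0∞, t ^ q *
        volume ((ball 0 (2 * ρ) \ ball 0 ρ) ∩ {x | t < T x}) ≤
        C * (N ^ q * ENNReal.ofReal ρ ^ ((α - d) * q + n)) := by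
  have hpq := le_of_one_div_sub_eq le_rfl hγ hq0 hq
  obtain ⟨C₁, hC₁⟩ := exists_rpow_le_maxFn_add hn d le_rfl hα hγ hγα hq0 hq C₀
  obtain ⟨C₂, hC₂⟩ := exists_mul_volume_maxFn_le hn
  set K : ℝ≥0∞ := C₁ * (2 * (C₂ + 2 ^ n * unitVol n)) with hK
  have hKt : K ≠ ⊤ := by
    refine ENNReal.mul_ne_top (by simp) (ENNReal.mul_ne_top (by simp) (ENNReal.add_ne_top.2
      ⟨by simp, ENNReal.mul_ne_top (by simp) unitVol_ne_top⟩))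
  refine ⟨K.toNNReal, fun g N T hg hN h hT ρ hρ t => ?_⟩
  rw [ENNReal.coe_toNNReal hKt]
  set Λ := N * ENNReal.ofReal ρ ^ (-d) with hΛ
  have hΛt : Λ ≠ ⊤ := ENNReal.mul_ne_top hN (ofReal_rpow_ne_top hρ _)
  set M := maxFn (annulusPart g ρ)
  set B := C₁ * (ENNReal.ofReal ρ ^ (α * q) * Λ ^ (q - 1)) with hB
  have hBt : B ≠ ⊤ := ENNReal.mul_ne_top (by simp) (ENNReal.mul_ne_top (ofReal_rpow_ne_top hρ _)
    (ENNReal.rpow_ne_top_of_nonneg (by linarith) hΛt))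
  have hTM : ∀ x ∈ ball (0 : E n) (2 * ρ) \ ball 0 ρ, t < T x → t ^ q < B * (M x + Λ) := by
    intro x hx htx
    refine (ENNReal.rpow_lt_rpow htx hq0).trans_le ((hC₁ g N T hg hN h hT ρ hρ x hx).trans ?_)
    rw [ENNReal.rpow_one, hB]
    exact le_of_eq (by ring)
  rcases eq_or_ne B 0 with hB0 | hB0
  · have : (ball 0 (2 * ρ) \ ball 0 ρ) ∩ {x | t < T x} = ∅ := by
      refine eq_empty_of_forall_notMem fun x hx => ?_
      simpa [hB0] using hTM x hx.1 hx.2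
    simp [this]
  set v := t ^ q / (2 * B) with hv
  have h2B0 : 2 * B ≠ 0 := mul_ne_zero (by simp) hB0
  have h2Bt : 2 * B ≠ ⊤ := ENNReal.mul_ne_top (by simp) hBt
  have hvt : t ^ q = 2 * B * v := (ENNReal.mul_div_cancel h2B0 h2Bt).symm
  -- If `t ^ q = 2 B v < B (M + Λ)` then `M` or `Λ` exceeds `v`. As `Λ` is constant, the second set
  -- is the whole annulus or empty.
  have hsub : (ball 0 (2 * ρ) \ ball 0 ρ) ∩ {x | t < T x} ⊆
      {x | v < M x} ∪ ((ball 0 (2 * ρ) \ ball 0 ρ) ∩ {_x | v < Λ}) := by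
    intro x hx
    by_contra hcon
    simp only [mem_union, mem_ofPred_eq, mem_inter_iff, hx.1, true_and, not_or, not_lt] at hcon
    refine absurd (hTM x hx.1 hx.2) (not_lt.2 ?_)
    calc B * (M x + Λ) ≤ B * (v + v) := by gcongr; exacts [hcon.1, hcon.2]
      _ = t ^ q := by rw [hvt]; ring
  have h1 : v * volume {x | v < M x} ≤ C₂ * (Λ * ENNReal.ofReal ρ ^ (n : ℝ)) := by
    refine (hC₂ _ v).trans ?_
    gcongr
    simpa using lintegral_annulusPart_rpow_le one_pos h hρ
  have h2 : v * volume ((ball (0 : E n) (2 * ρ) \ ball 0 ρ) ∩ {_x | v < Λ}) ≤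
      Λ * (2 ^ n * unitVol n * ENNReal.ofReal ρ ^ (n : ℝ)) := by
    by_cases hvΛ : v < Λ
    · gcongr
      exact (measure_mono inter_subset_left).trans (volume_annulus_le hρ)
    · simp [hvΛ]
  calc t ^ q * volume ((ball 0 (2 * ρ) \ ball 0 ρ) ∩ {x | t < T x})
      ≤ 2 * B * v * (volume {x | v < M x} +
          volume ((ball (0 : E n) (2 * ρ) \ ball 0 ρ) ∩ {_x | v < Λ})) := by
        rw [hvt]
        gcongr
        exact (measure_mono hsub).trans (measure_union_le _ _)
    _ = 2 * B * (v * volume {x | v < M x} +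
          v * volume ((ball (0 : E n) (2 * ρ) \ ball 0 ρ) ∩ {_x | v < Λ})) := by ring
    _ ≤ 2 * B * (C₂ * (Λ * ENNReal.ofReal ρ ^ (n : ℝ)) +
          Λ * (2 ^ n * unitVol n * ENNReal.ofReal ρ ^ (n : ℝ))) := by gcongr
    _ = K * (ENNReal.ofReal ρ ^ (α * q) * (Λ ^ (q - 1) *
          (Λ ^ (1 : ℝ) * ENNReal.ofReal ρ ^ (n : ℝ)))) := by
        rw [hK, hB, ENNReal.rpow_one]; ring
    _ = _ := by rw [mul_rpow_scale zero_le_one hpq hρ]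

/-! ### Local Morrey norms and annular bounds -/

lemma ofReal_samko {r : ℝ} (hr : 0 < r) (lam : ℝ) :
    ENNReal.ofReal (samko lam r) = ENNReal.ofReal r ^ lam := by
  rw [samko, ENNReal.ofReal_rpow_of_pos hr]

lemma ofReal_powerWeight {x : E n} (hx : 0 < ‖x‖) (β s : ℝ) :
    ENNReal.ofReal (powerWeight β s x) = ENNReal.ofReal ‖x‖ ^ (β * s) := by
  rw [powerWeight, ← Real.rpow_mul hx.le, ENNReal.ofReal_rpow_of_pos hx]

lemma measurable_powerWeight (β s : ℝ) :
    Measurable fun x : E n => ENNReal.ofReal (powerWeight β s x) := by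
  unfold powerWeight; fun_prop

lemma lintegral_le_of_lmNorm {F : Type*} [ENorm F] {p lam : ℝ} (hp : 0 < p) {w : E n → ℝ}
    (f : E n → F) {r : ℝ} (hr : 0 < r) :
    ∫⁻ x in ball (0 : E n) r, ‖f x‖ₑ ^ p * ENNReal.ofReal (w x) ≤
      lmNorm p (samko lam) w f ^ p * ENNReal.ofReal r ^ lam := by
  rw [← ENNReal.div_le_iff (ofReal_rpow_ne_zero hr _) (ofReal_rpow_ne_top hr _),
    ← ENNReal.rpow_inv_le_iff hp, ← one_div, ← ofReal_samko hr]
  exact le_iSup₂_of_le r hr le_rfl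

lemma lmNorm_le {F : Type*} [ENorm F] {p lam : ℝ} (hp : 0 < p) {w : E n → ℝ}
    {f : E n → F} {C N : ℝ≥0∞}
    (h : ∀ r : ℝ, 0 < r → ∫⁻ x in ball (0 : E n) r, ‖f x‖ₑ ^ p * ENNReal.ofReal (w x) ≤
      C * (N ^ p * ENNReal.ofReal r ^ lam)) :
    lmNorm p (samko lam) w f ≤ C ^ (1 / p) * N := by
  refine iSup₂_le fun r hr => ?_
  rw [ofReal_samko hr, one_div, ENNReal.rpow_inv_le_iff hp,
    ENNReal.div_le_iff (ofReal_rpow_ne_zero hr _) (ofReal_rpow_ne_top hr _),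
    ENNReal.mul_rpow_of_nonneg _ _ hp.le, ENNReal.rpow_inv_rpow hp.ne', mul_assoc]
  exact h r hr

lemma wlmNorm_le {F : Type*} [ENorm F] {p lam : ℝ} (hp : 0 < p) {w : E n → ℝ}
    {f : E n → F} {C N : ℝ≥0∞}
    (h : ∀ r : ℝ, 0 < r → ∀ t : ℝ≥0∞, t ^ p *
      ∫⁻ x in {x ∈ ball (0 : E n) r | t < ‖f x‖ₑ}, ENNReal.ofReal (w x) ≤
      C * (N ^ p * ENNReal.ofReal r ^ lam)) :
    wlmNorm p (samko lam) w f ≤ C ^ (1 / p) * N := by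
  refine iSup₂_le fun r hr => iSup₂_le fun t ht => ?_
  have h0 := ofReal_rpow_ne_zero hr lam
  have h1 := ofReal_rpow_ne_top hr lam
  rw [ofReal_samko hr, ENNReal.div_le_iff (by simp [ENNReal.rpow_eq_zero_iff, h0, h1])
    (by simp [ENNReal.rpow_eq_top_iff, h0, h1])]
  have := ENNReal.rpow_le_rpow (h r hr t) (by positivity : 0 ≤ 1 / p)
  rw [ENNReal.mul_rpow_of_nonneg _ _ (by positivity),
    ENNReal.mul_rpow_of_nonneg _ _ (by positivity),
    ENNReal.mul_rpow_of_nonneg _ _ (by positivity), ← ENNReal.rpow_mul, ← ENNReal.rpow_mul N,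
    mul_one_div_cancel hp.ne', ENNReal.rpow_one, ENNReal.rpow_one] at this
  rwa [mul_assoc]

lemma le_of_wlmNorm {F : Type*} [ENorm F] {p lam : ℝ} (hp : 0 < p) {w : E n → ℝ}
    (f : E n → F) {r : ℝ} (hr : 0 < r) {t : ℝ≥0} (ht : 0 < t) :
    (t : ℝ≥0∞) ^ p * ∫⁻ x in {x ∈ ball (0 : E n) r | t < ‖f x‖ₑ}, ENNReal.ofReal (w x) ≤
      wlmNorm p (samko lam) w f ^ p * ENNReal.ofReal r ^ lam := by
  have h0 := ofReal_rpow_ne_zero hr lam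
  have h1 := ofReal_rpow_ne_top hr lam
  have : (t : ℝ≥0∞) * (∫⁻ x in {x ∈ ball (0 : E n) r | (t : ℝ≥0∞) < ‖f x‖ₑ},
      ENNReal.ofReal (w x)) ^ (1 / p) ≤
      wlmNorm p (samko lam) w f * (ENNReal.ofReal r ^ lam) ^ (1 / p) := by
    rw [← ENNReal.div_le_iff (by simp [ENNReal.rpow_eq_zero_iff, h0, h1])
      (by simp [ENNReal.rpow_eq_top_iff, h0, h1]), ← ofReal_samko hr]
    exact le_iSup₂_of_le r hr (le_iSup₂_of_le t ht le_rfl)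
  have := ENNReal.rpow_le_rpow this hp.le
  rwa [ENNReal.mul_rpow_of_nonneg _ _ hp.le, ENNReal.mul_rpow_of_nonneg _ _ hp.le,
    ← ENNReal.rpow_mul, ← ENNReal.rpow_mul, one_div_mul_cancel hp.ne', ENNReal.rpow_one,
    ENNReal.rpow_one] at this

/-- Chebyshev's inequality on each ball; it reduces necessity to the weak norm for every `p`. -/
lemma wlmNorm_le_lmNorm {F : Type*} [ENorm F] {p lam : ℝ} (hp : 0 < p) {w : E n → ℝ}
    {f : E n → F} (hf : AEMeasurable fun x => ‖f x‖ₑ) :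
    wlmNorm p (samko lam) w f ≤ lmNorm p (samko lam) w f := by
  have := wlmNorm_le (lam := lam) (w := w) (f := f) (C := 1) (N := lmNorm p (samko lam) w f) hp
    fun r hr t => ?_
  · simpa using this
  rw [one_mul]
  refine le_trans ?_ (lintegral_le_of_lmNorm hp f hr)
  have hs : NullMeasurableSet {x ∈ ball (0 : E n) r | t < ‖f x‖ₑ} :=
    measurableSet_ball.nullMeasurableSet.inter (nullMeasurableSet_lt aemeasurable_const hf)
  calc _ ≤ ∫⁻ x in {x ∈ ball (0 : E n) r | t < ‖f x‖ₑ}, t ^ p * ENNReal.ofReal (w x) :=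
        lintegral_const_mul_le _ _
    _ ≤ ∫⁻ x in {x ∈ ball (0 : E n) r | t < ‖f x‖ₑ}, ‖f x‖ₑ ^ p * ENNReal.ofReal (w x) := by
        refine lintegral_mono_ae ?_
        filter_upwards [ae_restrict_mem₀ hs] with x hx
        gcongr
        exact hx.2.le
    _ ≤ _ := lintegral_mono_set fun x hx => hx.1

lemma ae_norm_pos (hn : 0 < n) : ∀ᵐ x : E n, 0 < ‖x‖ := by
  filter_upwards [measure_eq_zero_iff_ae_notMem.1 (volume_singleton_eq_zero hn (0 : E n))]
    with x hx using norm_pos_iff.2 hx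

lemma volume_eq_zero_of_lintegral_powerWeight (hn : 0 < n) {β s : ℝ} {S : Set (E n)}
    (h : ∫⁻ x in S, ENNReal.ofReal (powerWeight β s x) = 0) : volume S = 0 := by
  rw [lintegral_eq_zero_iff (measurable_powerWeight β s)] at h
  have h2 : ∀ᵐ x ∂(volume.restrict S), False := by
    filter_upwards [h, ae_restrict_of_ae (ae_norm_pos hn)] with x hx hx0
    rw [ofReal_powerWeight hx0] at hx
    exact ofReal_rpow_ne_zero hx0 _ hx
  simpa using h2

/-- Functions with finite weak norm are finite almost everywhere. -/
lemma ae_enorm_lt_top_of_wlmNorm (hn : 0 < n) {F : Type*} [ENorm F] {p lam β s : ℝ} (hp : 0 < p)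
    {f : E n → F} (hf : wlmNorm p (samko lam) (powerWeight β s) f < ⊤) :
    ∀ᵐ x, ‖f x‖ₑ < ⊤ := by
  have key : ∀ k : ℕ, volume {x ∈ ball (0 : E n) (k + 1) | ‖f x‖ₑ = ⊤} = 0 := by
    intro k
    apply volume_eq_zero_of_lintegral_powerWeight hn (β := β) (s := s)
    have hk : (0 : ℝ) < k + 1 := by positivity
    by_contra hne
    -- The weak bound at level `t ^ (1/p)`: the weighted mass of the infinity set, multiplied by any
    -- `t`, stays below a fixed finite bound.
    have hbd : ∀ t : ℝ≥0, (t : ℝ≥0∞) *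
        ∫⁻ x in {x ∈ ball (0 : E n) (k + 1) | ‖f x‖ₑ = ⊤}, ENNReal.ofReal (powerWeight β s x) ≤
        wlmNorm p (samko lam) (powerWeight β s) f ^ p * ENNReal.ofReal (k + 1) ^ lam := by
      intro t
      rcases eq_or_ne t 0 with rfl | ht
      · simp
      have ht' : 0 < t ^ (1 / p) := NNReal.rpow_pos (pos_iff_ne_zero.2 ht)
      refine le_trans ?_ (le_of_wlmNorm hp f hk ht')
      rw [ENNReal.coe_rpow_of_nonneg _ (by positivity), ← ENNReal.rpow_mul,
        one_div_mul_cancel hp.ne', ENNReal.rpow_one]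
      gcongr
      intro hx
      rw [hx]
      exact ENNReal.rpow_lt_top_of_nonneg (by positivity) (by simp)
    have hfin : wlmNorm p (samko lam) (powerWeight β s) f ^ p * ENNReal.ofReal (k + 1) ^ lam ≠ ⊤ :=
      ENNReal.mul_ne_top (ENNReal.rpow_ne_top_of_nonneg hp.le hf.ne) (ofReal_rpow_ne_top hk _)
    obtain ⟨m, hm⟩ := ENNReal.exists_nat_mul_gt hne hfin
    exact absurd hm (not_lt.2 (by simpa using hbd m))
  rw [ae_iff]
  refine measure_mono_null (fun x hx => ?_) (measure_iUnion_null key)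
  obtain ⟨k, hk⟩ := exists_nat_gt ‖x‖
  refine mem_iUnion.2 ⟨k, ?_, by simpa using hx⟩
  rw [mem_ball_zero_iff]; linarith

/-- Membership in the local Morrey space gives bounds on dyadic annuli. -/
lemma exists_dyadicBound_of_lmNorm {F : Type*} [ENorm F] {p lam β : ℝ} (hp : 0 < p) :
    ∃ C : ℝ≥0, ∀ f : E n → F,
      DyadicBound p (β + (n - lam) / p) (fun x => ‖f x‖ₑ)
        (C * lmNorm p (samko lam) (powerWeight β p) f) := by
  obtain ⟨C, -, hC⟩ := exists_rpow_le_of_comparable (-(β * p))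
  set K : ℝ≥0∞ := (C * ENNReal.ofReal 4 ^ lam) ^ (1 / p) with hK
  have hKt : K ≠ ⊤ := ENNReal.rpow_ne_top_of_nonneg (by positivity)
    (ENNReal.mul_ne_top (by simp) (ofReal_rpow_ne_top (by norm_num) _))
  refine ⟨K.toNNReal, fun f ρ hρ => ?_⟩
  rw [ENNReal.coe_toNNReal hKt]
  set N := lmNorm p (samko lam) (powerWeight β p) f
  have hB : (C : ℝ≥0∞) * ENNReal.ofReal ρ ^ (-(β * p)) ≠ ⊤ :=
    ENNReal.mul_ne_top (by simp) (ofReal_rpow_ne_top hρ _)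
  calc ∫⁻ y in ball 0 (4 * ρ) \ ball 0 (ρ / 2), ‖f y‖ₑ ^ p
      ≤ ∫⁻ y in ball 0 (4 * ρ) \ ball 0 (ρ / 2), C * ENNReal.ofReal ρ ^ (-(β * p)) *
          (‖f y‖ₑ ^ p * ENNReal.ofReal (powerWeight β p y)) := by
        refine setLIntegral_mono' (measurableSet_ball.diff measurableSet_ball) fun y hy => ?_
        have hy1 : ‖y‖ < 4 * ρ := by simpa using hy.1
        have hy2 : ρ / 2 ≤ ‖y‖ := by simpa using hy.2
        have hy0 : 0 < ‖y‖ := by linarith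
        rw [ofReal_powerWeight hy0]
        calc ‖f y‖ₑ ^ p = ENNReal.ofReal ‖y‖ ^ (-(β * p)) *
              (‖f y‖ₑ ^ p * ENNReal.ofReal ‖y‖ ^ (β * p)) := by
              rw [mul_left_comm, ← ofReal_rpow_add hy0]; simp
          _ ≤ _ := by gcongr; exact hC ρ _ hρ (by linarith) (by linarith)
    _ = C * ENNReal.ofReal ρ ^ (-(β * p)) * ∫⁻ y in ball 0 (4 * ρ) \ ball 0 (ρ / 2),
          ‖f y‖ₑ ^ p * ENNReal.ofReal (powerWeight β p y) := lintegral_const_mul' _ _ hB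
    _ ≤ C * ENNReal.ofReal ρ ^ (-(β * p)) * (N ^ p * ENNReal.ofReal (4 * ρ) ^ lam) := by
        gcongr
        exact (lintegral_mono_set sdiff_subset).trans (lintegral_le_of_lmNorm hp f (by positivity))
    _ = (C * ENNReal.ofReal 4 ^ lam) * N ^ p *
          (ENNReal.ofReal ρ ^ (-(β * p)) * ENNReal.ofReal ρ ^ lam) := by
        rw [ofReal_mul_rpow (by norm_num)]; ring
    _ = _ := by
        rw [ENNReal.mul_rpow_of_nonneg _ _ hp.le, hK, ← ENNReal.rpow_mul,
          one_div_mul_cancel hp.ne', ENNReal.rpow_one, ← ofReal_rpow_add hρ]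
        congr 2
        field_simp
        ring

lemma exists_powerWeight_le (β s : ℝ) :
    ∃ C : ℝ≥0, ∀ ρ : ℝ, 0 < ρ → ∀ x ∈ ball (0 : E n) (2 * ρ) \ ball 0 ρ,
      ENNReal.ofReal (powerWeight β s x) ≤ C * ENNReal.ofReal ρ ^ (β * s) := by
  obtain ⟨C, -, hC⟩ := exists_rpow_le_of_comparable (β * s)
  refine ⟨C, fun ρ hρ x hx => ?_⟩
  have hx1 : ‖x‖ < 2 * ρ := by simpa using hx.1
  have hx2 : ρ ≤ ‖x‖ := by simpa using hx.2
  rw [ofReal_powerWeight (by linarith)]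
  exact hC _ _ hρ (by linarith) (by linarith)

/-- Dyadic bounds on annuli of `∫ |h|^q` give a bound of the weighted local Morrey norm of `h`. -/
lemma exists_lmNorm_le_of_annuli (hn : 0 < n) {F : Type*} [ENorm F] {q lam β e : ℝ} (hq : 0 < q)
    (hlam : 0 < lam) (he : β * q + e = lam) (C₁ : ℝ≥0) :
    ∃ C : ℝ≥0, ∀ (h : E n → F) (N : ℝ≥0∞),
      (∀ ρ : ℝ, 0 < ρ → ∫⁻ x in ball 0 (2 * ρ) \ ball 0 ρ, ‖h x‖ₑ ^ q ≤
        C₁ * (N ^ q * ENNReal.ofReal ρ ^ e)) →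
      lmNorm q (samko lam) (powerWeight β q) h ≤ C * N := by
  obtain ⟨C₂, hC₂⟩ := exists_powerWeight_le (n := n) β q
  obtain ⟨C₃, hC₃⟩ := measure_ball_le_of_annuli (X := E n) hlam
  refine ⟨(C₃ * (C₂ * C₁)) ^ (1 / q), fun h N hh => ?_⟩
  rw [ENNReal.coe_rpow_of_nonneg _ (by positivity)]
  refine lmNorm_le hq fun r hr => ?_
  have := hC₃ (volume.withDensity fun x => ‖h x‖ₑ ^ q * ENNReal.ofReal (powerWeight β q x)) 0
    (C₂ * C₁ * N ^ q)
    (withDensity_absolutelyContinuous _ _ (volume_singleton_eq_zero hn 0)) (fun ρ hρ => ?_) r hr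
  · rw [withDensity_apply _ measurableSet_ball] at this
    refine this.trans (le_of_eq ?_)
    push_cast; ring
  rw [withDensity_apply _ (measurableSet_ball.diff measurableSet_ball)]
  calc _ ≤ ∫⁻ x in ball 0 (2 * ρ) \ ball 0 ρ,
          C₂ * ENNReal.ofReal ρ ^ (β * q) * ‖h x‖ₑ ^ q := by
        refine setLIntegral_mono' (measurableSet_ball.diff measurableSet_ball) fun x hx => ?_
        rw [mul_comm]
        gcongr
        exact hC₂ ρ hρ x hx
    _ = C₂ * ENNReal.ofReal ρ ^ (β * q) * ∫⁻ x in ball 0 (2 * ρ) \ ball 0 ρ, ‖h x‖ₑ ^ q :=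
        lintegral_const_mul' _ _ (ENNReal.mul_ne_top (by simp) (ofReal_rpow_ne_top hρ _))
    _ ≤ C₂ * ENNReal.ofReal ρ ^ (β * q) * (C₁ * (N ^ q * ENNReal.ofReal ρ ^ e)) := by
        gcongr; exact hh ρ hρ
    _ = _ := by rw [← he, ofReal_rpow_add hρ]; ring

/-- Weak type version of `exists_lmNorm_le_of_annuli`. -/
lemma exists_wlmNorm_le_of_annuli (hn : 0 < n) {F : Type*} [ENorm F] {q lam β e : ℝ} (hq : 0 < q)
    (hlam : 0 < lam) (he : β * q + e = lam) (C₁ : ℝ≥0) :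
    ∃ C : ℝ≥0, ∀ (h : E n → F) (N : ℝ≥0∞),
      (∀ ρ : ℝ, 0 < ρ → ∀ t : ℝ≥0∞, t ^ q *
        volume ((ball 0 (2 * ρ) \ ball 0 ρ) ∩ {x | t < ‖h x‖ₑ}) ≤
        C₁ * (N ^ q * ENNReal.ofReal ρ ^ e)) →
      wlmNorm q (samko lam) (powerWeight β q) h ≤ C * N := by
  obtain ⟨C₂, hC₂⟩ := exists_powerWeight_le (n := n) β q
  obtain ⟨C₃, hC₃⟩ := measure_ball_le_of_annuli (X := E n) hlam
  refine ⟨(C₃ * (C₂ * C₁)) ^ (1 / q), fun h N hh => ?_⟩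
  rw [ENNReal.coe_rpow_of_nonneg _ (by positivity)]
  refine wlmNorm_le hq fun r hr t => ?_
  -- For fixed `t` the weighted distribution function is a measure in the ball variable, so the
  -- annular summation applies; the superlevel set need not be measurable.
  have := hC₃ (t ^ q • (volume.restrict {x | t < ‖h x‖ₑ}).withDensity
      fun x => ENNReal.ofReal (powerWeight β q x)) 0
    (C₂ * C₁ * N ^ q) ?_ (fun ρ hρ => ?_) r hr
  · rw [Measure.smul_apply, withDensity_apply _ measurableSet_ball,
      Measure.restrict_restrict measurableSet_ball] at this
    refine this.trans (le_of_eq ?_)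
    push_cast; ring
  · rw [Measure.smul_apply, withDensity_absolutelyContinuous _ _, smul_zero]
    exact le_antisymm ((Measure.restrict_le_self _).trans
      (volume_singleton_eq_zero hn 0).le) zero_le
  rw [Measure.smul_apply, withDensity_apply _ (measurableSet_ball.diff measurableSet_ball),
    smul_eq_mul]
  calc _ ≤ t ^ q * ∫⁻ x in ball 0 (2 * ρ) \ ball 0 ρ,
          C₂ * ENNReal.ofReal ρ ^ (β * q) ∂volume.restrict {x | t < ‖h x‖ₑ} := by
        gcongr t ^ q * ?_
        exact setLIntegral_mono' (measurableSet_ball.diff measurableSet_ball) (hC₂ ρ hρ)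
    _ = C₂ * ENNReal.ofReal ρ ^ (β * q) * (t ^ q *
          volume ((ball 0 (2 * ρ) \ ball 0 ρ) ∩ {x | t < ‖h x‖ₑ})) := by
        rw [setLIntegral_const, Measure.restrict_apply (measurableSet_ball.diff measurableSet_ball)]
        ring
    _ ≤ C₂ * ENNReal.ofReal ρ ^ (β * q) * (C₁ * (N ^ q * ENNReal.ofReal ρ ^ e)) := by
        gcongr _ * ?_; exact hh ρ hρ t
    _ = _ := by rw [← he, ofReal_rpow_add hρ]; ring

/-! ### Sufficiency -/

lemma ae_maxFn_lt_top (hn : 0 < n) {g : E n → ℝ≥0∞} (hg : ∫⁻ y, g y ≠ ⊤) :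
    ∀ᵐ x, maxFn g x < ⊤ := by
  obtain ⟨C, hC⟩ := exists_mul_volume_maxFn_le hn
  rw [ae_iff]
  by_contra hne
  obtain ⟨m, hm⟩ := ENNReal.exists_nat_mul_gt hne (ENNReal.mul_ne_top (by simp : (C : ℝ≥0∞) ≠ ⊤) hg)
  refine absurd hm (not_lt.2 (le_trans ?_ (hC g m)))
  gcongr
  intro h
  rw [not_lt, top_le_iff] at h
  simp [h]

/-- Needed for the absolute convergence of the fractional integral. The pieces of `g` on annuli are
integrable, so their maximal functions are finite a.e.; the countably many radii `2 ^ k`, `k : ℤ`,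
reach every `x ≠ 0`. -/
lemma ae_localInt_lt_top (hn : 0 < n) {p q α γ d : ℝ} (hp : 1 ≤ p)
    (hα : 0 < α) (hγ : 0 ≤ γ) (hγα : γ ≤ α) (hq0 : 0 < q) (hq : 1 / p - 1 / q = γ / n)
    (hdn : d < n) {g : E n → ℝ≥0∞} {N : ℝ≥0∞} (hg : AEMeasurable g) (hN : N ≠ ⊤)
    (h : DyadicBound p d g N) : ∀ᵐ x, localInt α g x < ⊤ := by
  have hpq := le_of_one_div_sub_eq hp hγ hq0 hq
  obtain ⟨C, hC⟩ := exists_localInt_le hn d hp hα hγ hγα hq0 hq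
  obtain ⟨C₁, hC₁⟩ := exists_lintegral_ball_le hn hp hdn
  have key : ∀ ρ : ℝ, 0 < ρ → ∀ᵐ x, maxFn (annulusPart g ρ) x < ⊤ := fun ρ hρ => by
    refine ae_maxFn_lt_top hn (ne_top_of_le_ne_top ?_ (((lintegral_indicator_le _ _).trans
      (lintegral_mono_set sdiff_subset)).trans (hC₁ g N hg h (4 * ρ) (by positivity))))
    exact ENNReal.mul_ne_top (ENNReal.mul_ne_top (by simp) hN)
      (ofReal_rpow_ne_top (by positivity) _)
  have key2 : ∀ᵐ x : E n, ∀ k : ℤ, maxFn (annulusPart g (2 ^ k)) x < ⊤ :=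
    ae_all_iff.2 fun k => key _ (by positivity)
  filter_upwards [key2, ae_norm_pos hn] with x hx hx0
  obtain ⟨k, hk1, hk2⟩ := exists_mem_Ico_zpow hx0 (by norm_num : (1 : ℝ) < 2)
  have hρ : (0 : ℝ) < 2 ^ k := by positivity
  refine (hC g N hg hN h (2 ^ k) hρ x ⟨?_, ?_⟩).trans_lt (ENNReal.mul_lt_top (by simp)
    (ENNReal.mul_lt_top (ofReal_rpow_ne_top hρ _).lt_top (ENNReal.mul_lt_top ?_ ?_)))
  · rw [mem_ball_zero_iff, mul_comm, ← zpow_add_one₀ (by norm_num)]; exact hk2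
  · simpa using hk1
  · exact ENNReal.rpow_lt_top_of_nonneg (by positivity) (hx k).ne
  · refine ENNReal.rpow_lt_top_of_nonneg ?_ (ENNReal.mul_ne_top hN (ofReal_rpow_ne_top hρ _))
    rwa [sub_nonneg, div_le_one hq0]

/-- The norm `N₂` controls functions dominated by the sum of a power and a local fractional
integral. -/
def ControlsLocal {F : Type*} [ENorm F] (α p d : ℝ) (N₂ : (E n → F) → ℝ≥0∞) : Prop :=
  ∀ C₀ : ℝ≥0, ∃ C : ℝ≥0, ∀ (g : E n → ℝ≥0∞) (N : ℝ≥0∞) (h : E n → F), AEMeasurable g → N ≠ ⊤ →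
    DyadicBound p d g N →
    (∀ x ≠ 0, ‖h x‖ₑ ≤ C₀ * (N * ENNReal.ofReal ‖x‖ ^ (α - d) + localInt α g x)) →
    N₂ h ≤ C * N

/-- The equation `he` is the homogeneity condition: weight and annular bound multiply to `ρ ^ lam`.
-/
lemma controlsLocal_lmNorm (hn : 0 < n) {F : Type*} [ENorm F] {p q α γ d lam β : ℝ} (hp : 1 < p)
    (hα : 0 < α) (hγ : 0 ≤ γ) (hγα : γ ≤ α) (hq0 : 0 < q) (hq : 1 / p - 1 / q = γ / n)
    (hlam : 0 < lam) (he : β * q + ((α - d) * q + n) = lam) :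
    ControlsLocal α p d (lmNorm (n := n) (F := F) q (samko lam) (powerWeight β q)) := by
  intro C₀
  obtain ⟨C₁, hC₁⟩ := exists_lintegral_annulus_rpow_le hn d hp hα hγ hγα hq0 hq C₀
  obtain ⟨C, hC⟩ := exists_lmNorm_le_of_annuli (F := F) hn hq0 hlam he C₁
  exact ⟨C, fun g N h hg hN hD hh => hC h N (hC₁ g N _ hg hN hD hh)⟩

lemma controlsLocal_wlmNorm (hn : 0 < n) {F : Type*} [ENorm F] {q α γ d lam β : ℝ}
    (hα : 0 < α) (hγ : 0 ≤ γ) (hγα : γ ≤ α) (hq0 : 0 < q) (hq : 1 / 1 - 1 / q = γ / n)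
    (hlam : 0 < lam) (he : β * q + ((α - d) * q + n) = lam) :
    ControlsLocal α 1 d (wlmNorm (n := n) (F := F) q (samko lam) (powerWeight β q)) := by
  intro C₀
  obtain ⟨C₁, hC₁⟩ := exists_volume_annulus_le hn d hα hγ hγα hq0 hq C₀
  obtain ⟨C, hC⟩ := exists_wlmNorm_le_of_annuli (F := F) hn hq0 hlam he C₁
  exact ⟨C, fun g N h hg hN hD hh => hC h N (hC₁ g N _ hg hN hD hh)⟩

lemma measurable_fracMax (α : ℝ) (f : E n → 𝕜) : Measurable (fracMax α f) :=
  measurable_iSup_ball fun c r =>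
    (∫⁻ y in ball c r, ‖f y‖ₑ) / volume (ball c r) ^ (1 - α / n)

lemma boundedOp_fracMax (hn : 0 < n) {p α lam β : ℝ} (hp : 1 ≤ p) (hαn : α < n)
    {N₂ : (E n → ℝ≥0∞) → ℝ≥0∞} (hN₂ : ControlsLocal α p (β + (n - lam) / p) N₂)
    (hd : α ≤ β + (n - lam) / p) (hdn : β + (n - lam) / p < n) :
    BoundedOp (n := n) (𝕜 := 𝕜) (fracMax α) FracMaxDefined
      (lmNorm p (samko lam) (powerWeight β p)) N₂ := by
  obtain ⟨C₁, hC₁⟩ := exists_dyadicBound_of_lmNorm (n := n) (F := 𝕜) (lam := lam) (β := β)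
    (by linarith : 0 < p)
  obtain ⟨C₂, hC₂⟩ := exists_average_le hn hp hαn hd hdn
  obtain ⟨C₃, hC₃⟩ := exists_lintegral_ball_le hn hp hdn
  obtain ⟨C, hC⟩ := hN₂ C₂
  refine ⟨C * C₁, fun f hf hfin => ⟨?_, (measurable_fracMax α f).aestronglyMeasurable, ?_⟩⟩
  · intro x
    refine ⟨ball 0 (‖x‖ + 1), isOpen_ball.mem_nhds (by simp), hf.restrict, ?_⟩
    refine (hC₃ _ _ hf.enorm (hC₁ f) (‖x‖ + 1) (by positivity)).trans_lt ?_
    exact ENNReal.mul_lt_top (ENNReal.mul_lt_top (by simp) (ENNReal.mul_lt_top (by simp) hfin))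
      (ofReal_rpow_ne_top (by positivity) _).lt_top
  · refine (hC _ _ _ hf.enorm (ENNReal.mul_ne_top (by simp) hfin.ne) (hC₁ f) fun x hx => ?_).trans
      (le_of_eq ?_)
    · exact iSup₂_le fun c r => iSup_le fun hxc => hC₂ _ _ hf.enorm (hC₁ f) x hx c r hxc
    · push_cast; ring

/-- Only an inequality: at `y = x` the real kernel is `0⁻¹ = 0`, the extended one is `⊤`. -/
lemma enorm_fracIntegrand_le {α : ℝ} (hαn : α < n) (f : E n → 𝕜) (x y : E n) :
    ‖fracIntegrand α f x y‖ₑ ≤ ‖f y‖ₑ * ENNReal.ofReal ‖x - y‖ ^ (α - n) := by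
  rw [fracIntegrand, enorm_smul, mul_comm]
  gcongr
  rcases (norm_nonneg (x - y)).eq_or_lt with h | h
  · rw [← h, Real.zero_rpow (by linarith)]
    simp
  · rw [ENNReal.ofReal_rpow_of_pos h, ← Real.rpow_neg h.le, neg_sub,
      Real.enorm_of_nonneg (by positivity)]

lemma aestronglyMeasurable_fracIntegrand (α : ℝ) {f : E n → 𝕜} (hf : AEStronglyMeasurable f)
    (x : E n) : AEStronglyMeasurable (fracIntegrand α f x) := by
  have : Measurable fun y : E n => (‖x - y‖ ^ ((n : ℝ) - α))⁻¹ := by fun_prop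
  exact this.aestronglyMeasurable.smul hf

lemma aestronglyMeasurable_fracInt (α : ℝ) {f : E n → 𝕜} (hf : AEStronglyMeasurable f) :
    AEStronglyMeasurable (fracInt α f) := by
  have h1 : Measurable fun z : E n × E n => (‖z.1 - z.2‖ ^ ((n : ℝ) - α))⁻¹ := by fun_prop
  exact (h1.aestronglyMeasurable.smul hf.comp_snd).integral_prod_right'

/-- The pointwise bound gives the norm estimate; it also gives absolute convergence wherever the
local part is finite, hence almost everywhere. -/
lemma boundedOp_fracInt (hn : 0 < n) {p q α γ lam β : ℝ} (hp : 1 ≤ p) (hαn : α < n)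
    (hα : 0 < α) (hγ : 0 ≤ γ) (hγα : γ ≤ α) (hq0 : 0 < q) (hq : 1 / p - 1 / q = γ / n)
    {N₂ : (E n → 𝕜) → ℝ≥0∞} (hN₂ : ControlsLocal α p (β + (n - lam) / p) N₂)
    (hd : α < β + (n - lam) / p) (hdn : β + (n - lam) / p < n) :
    BoundedOp (n := n) (𝕜 := 𝕜) (fracInt α) (FracIntDefined α)
      (lmNorm p (samko lam) (powerWeight β p)) N₂ := by
  obtain ⟨C₁, hC₁⟩ := exists_dyadicBound_of_lmNorm (n := n) (F := 𝕜) (lam := lam) (β := β)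
    (by linarith : 0 < p)
  obtain ⟨C₂, hC₂⟩ := exists_lintegral_kernel_le hn hp hd hdn
  obtain ⟨C, hC⟩ := hN₂ C₂
  refine ⟨C * C₁, fun f hf hfin => ⟨?_, aestronglyMeasurable_fracInt α hf, ?_⟩⟩
  all_goals
    have hN : C₁ * lmNorm p (samko lam) (powerWeight β p) f ≠ ⊤ :=
      ENNReal.mul_ne_top (by simp) hfin.ne
    have hle : ∀ x : E n, x ≠ 0 → ∫⁻ y, ‖fracIntegrand α f x y‖ₑ ≤ _ := fun x hx =>
      (lintegral_mono fun y => enorm_fracIntegrand_le hαn f x y).trans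
        (hC₂ _ _ hf.enorm (hC₁ f) x hx)
  · filter_upwards [ae_localInt_lt_top hn hp hα hγ hγα hq0 hq hdn hf.enorm hN (hC₁ f),
      ae_norm_pos hn] with x hx hx0
    refine ⟨aestronglyMeasurable_fracIntegrand α hf x,
      (hle x (norm_pos_iff.1 hx0)).trans_lt (ENNReal.mul_lt_top (by simp)
        (ENNReal.add_lt_top.2 ⟨ENNReal.mul_lt_top hN.lt_top (ofReal_rpow_ne_top hx0 _).lt_top,
          hx⟩))⟩
  · refine (hC _ _ _ hf.enorm hN (hC₁ f) fun x hx => ?_).trans (le_of_eq ?_)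
    · exact (enorm_integral_le_lintegral_enorm _).trans (hle x hx)
    · push_cast; ring

/-! ### Necessity: test functions -/

lemma le_volume_annulus (hn : 0 < n) {ρ : ℝ} (hρ : 0 < ρ) :
    unitVol n * ENNReal.ofReal ρ ^ (n : ℝ) ≤ volume (ball (0 : E n) (2 * ρ) \ ball 0 ρ) := by
  rw [measure_sdiff (ball_subset_ball (by linarith)) measurableSet_ball.nullMeasurableSet
    measure_ball_lt_top.ne, volume_ball_eq _ hρ, volume_ball_eq _ (by positivity),
    ofReal_mul_rpow (by norm_num), ENNReal.ofReal_ofNat]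
  refine ENNReal.le_sub_of_add_le_right
    (ENNReal.mul_ne_top (ofReal_rpow_ne_top hρ _) unitVol_ne_top) ?_
  have h2 : (2 : ℝ≥0∞) ≤ 2 ^ (n : ℝ) := by
    rw [ENNReal.rpow_natCast]
    exact le_self_pow₀ (by norm_num) hn.ne'
  calc _ = 2 * ENNReal.ofReal ρ ^ (n : ℝ) * unitVol n := by ring
    _ ≤ _ := by gcongr

lemma exists_le_lintegral_annulus (hn : 0 < n) (e : ℝ) :
    ∃ c : ℝ≥0∞, c ≠ 0 ∧ ∀ ρ : ℝ, 0 < ρ →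
      c * ENNReal.ofReal ρ ^ (e + n) ≤
        ∫⁻ x in ball (0 : E n) (2 * ρ) \ ball 0 ρ, ENNReal.ofReal ‖x‖ ^ e := by
  obtain ⟨C, hC0, hC⟩ := exists_rpow_le_of_comparable e
  have hC0' : (C : ℝ≥0∞) ≠ 0 := by simpa using hC0.ne'
  refine ⟨(C : ℝ≥0∞)⁻¹ * unitVol n, mul_ne_zero (by simp) unitVol_ne_zero, fun ρ hρ => ?_⟩
  calc _ = (C : ℝ≥0∞)⁻¹ * ENNReal.ofReal ρ ^ e * (unitVol n * ENNReal.ofReal ρ ^ (n : ℝ)) := by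
        rw [ofReal_rpow_add hρ]; ring
    _ ≤ (C : ℝ≥0∞)⁻¹ * ENNReal.ofReal ρ ^ e * volume (ball (0 : E n) (2 * ρ) \ ball 0 ρ) := by
        gcongr; exact le_volume_annulus hn hρ
    _ = ∫⁻ _ in ball (0 : E n) (2 * ρ) \ ball 0 ρ, (C : ℝ≥0∞)⁻¹ * ENNReal.ofReal ρ ^ e := by
        rw [setLIntegral_const]
    _ ≤ _ := by
        refine setLIntegral_mono' (measurableSet_ball.diff measurableSet_ball) fun x hx => ?_
        have hx1 : ‖x‖ < 2 * ρ := by simpa using hx.1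
        have hx2 : ρ ≤ ‖x‖ := by simpa using hx.2
        rw [ENNReal.inv_mul_le_iff hC0' (by simp)]
        exact hC _ _ (by linarith) (by linarith) (by linarith)

/-- Continuity from above, contraposed: a finite measure could not stay above `c` along sets
shrinking to a null set. It covers the logarithmic borderline of divergent power integrals too. -/
lemma measure_eq_top_of_antitone {X : Type*} [MeasurableSpace X] (μ : Measure X) {s : ℕ → Set X}
    (hs : ∀ k, MeasurableSet (s k)) (hanti : Antitone s) (h0 : μ (⋂ k, s k) = 0) {c : ℝ≥0∞}
    (hc : c ≠ 0) (h : ∀ k, c ≤ μ (s k)) : μ (s 0) = ⊤ := by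
  by_contra hne
  have := tendsto_measure_iInter_atTop (μ := μ) (fun k => (hs k).nullMeasurableSet) hanti ⟨0, hne⟩
  rw [h0] at this
  exact hc (le_antisymm (ge_of_tendsto' this h) zero_le)

lemma lintegral_ball_rpow_eq_top (hn : 0 < n) {e : ℝ} (he : e + n ≤ 0) {ε : ℝ} (hε : 0 < ε) :
    ∫⁻ x in ball (0 : E n) ε, ENNReal.ofReal ‖x‖ ^ e = ⊤ := by
  obtain ⟨c, hc0, hc⟩ := exists_le_lintegral_annulus hn e
  have := measure_eq_top_of_antitone (volume.withDensity fun x : E n => ENNReal.ofReal ‖x‖ ^ e)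
    (s := fun k => ball 0 (ε / (k + 1))) (fun k => measurableSet_ball) ?_ ?_
    (c := c * ENNReal.ofReal ε ^ (e + n)) (mul_ne_zero hc0 (ofReal_rpow_ne_zero hε _)) ?_
  · rw [withDensity_apply _ measurableSet_ball] at this
    simpa using this
  · intro k l hkl
    exact ball_subset_ball (by gcongr)
  · have : ⋂ k : ℕ, ball (0 : E n) (ε / (k + 1)) ⊆ {0} := by
      intro x hx
      rw [mem_iInter] at hx
      by_contra hx0
      have hx0 : 0 < ‖x‖ := norm_pos_iff.2 hx0
      obtain ⟨k, hk⟩ := exists_nat_gt (ε / ‖x‖)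
      have h1 := hx k
      rw [mem_ball_zero_iff, lt_div_iff₀ (by positivity)] at h1
      rw [div_lt_iff₀ hx0] at hk
      nlinarith
    exact measure_mono_null this (withDensity_absolutelyContinuous _ _
      (volume_singleton_eq_zero hn 0))
  · intro k
    rw [withDensity_apply _ measurableSet_ball]
    have hk : 0 < ε / (k + 1) := by positivity
    have hk' : ε / (k + 1) ≤ ε := div_le_self hε.le (by linarith [(k.cast_nonneg : (0 : ℝ) ≤ k)])
    calc _ ≤ c * ENNReal.ofReal (ε / (k + 1) / 2) ^ (e + n) := by
          refine mul_le_mul' le_rfl (rpow_le_rpow_of_nonpos' ?_ he)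
          exact ENNReal.ofReal_le_ofReal (by linarith)
      _ ≤ _ := hc _ (by linarith)
      _ ≤ _ := lintegral_mono_set (sdiff_subset.trans (ball_subset_ball (by linarith)))

lemma lintegral_compl_ball_rpow_eq_top (hn : 0 < n) {e : ℝ} (he : 0 ≤ e + n) {R : ℝ}
    (hR : 0 < R) : ∫⁻ x in (ball (0 : E n) R)ᶜ, ENNReal.ofReal ‖x‖ ^ e = ⊤ := by
  obtain ⟨c, hc0, hc⟩ := exists_le_lintegral_annulus hn e
  have := measure_eq_top_of_antitone (volume.withDensity fun x : E n => ENNReal.ofReal ‖x‖ ^ e)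
    (s := fun k => (ball 0 (R * (k + 1)))ᶜ) (fun k => measurableSet_ball.compl) ?_ ?_
    (c := c * ENNReal.ofReal R ^ (e + n)) (mul_ne_zero hc0 (ofReal_rpow_ne_zero hR _)) ?_
  · rw [withDensity_apply _ measurableSet_ball.compl] at this
    simpa using this
  · intro k l hkl
    exact compl_subset_compl.2 (ball_subset_ball (by gcongr))
  · have : ⋂ k : ℕ, (ball (0 : E n) (R * (k + 1)))ᶜ = ∅ := by
      refine eq_empty_of_forall_notMem fun x hx => ?_
      rw [mem_iInter] at hx
      obtain ⟨k, hk⟩ := exists_nat_gt (‖x‖ / R)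
      have h1 := hx k
      rw [mem_compl_iff, mem_ball_zero_iff, not_lt] at h1
      rw [div_lt_iff₀ hR] at hk
      nlinarith
    rw [this, measure_empty]
  · intro k
    rw [withDensity_apply _ measurableSet_ball.compl]
    have hk : R ≤ R * (k + 1) := le_mul_of_one_le_right hR.le (by simp)
    calc _ ≤ c * ENNReal.ofReal (R * (k + 1)) ^ (e + n) := by gcongr
      _ ≤ _ := hc _ (by linarith)
      _ ≤ _ := lintegral_mono_set fun x hx => hx.2

/-- Functions bounded by `N |x| ^ (-d)` are in the local Morrey space of homogeneity `d`. -/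
lemma exists_lmNorm_le_of_le_rpow (hn : 0 < n) {F : Type*} [ENorm F] {p lam β : ℝ} (hp : 0 < p)
    (hlam : 0 < lam) :
    ∃ C : ℝ≥0, ∀ (h : E n → F) (N : ℝ≥0∞),
      (∀ x ≠ 0, ‖h x‖ₑ ≤ N * ENNReal.ofReal ‖x‖ ^ (-(β + (n - lam) / p))) →
      lmNorm p (samko lam) (powerWeight β p) h ≤ C * N := by
  set d := β + (n - lam) / p with hd
  obtain ⟨C₁, -, hC₁⟩ := exists_rpow_le_of_comparable (-d * p)
  have hCt : (C₁ * (2 ^ n * unitVol n) : ℝ≥0∞) ≠ ⊤ :=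
    ENNReal.mul_ne_top (by simp) (ENNReal.mul_ne_top (by simp) unitVol_ne_top)
  obtain ⟨C, hC⟩ := exists_lmNorm_le_of_annuli (n := n) (F := F) hn hp hlam (β := β)
    (e := -d * p + n) (by rw [hd]; field_simp; ring) (C₁ * (2 ^ n * unitVol n) : ℝ≥0∞).toNNReal
  refine ⟨C, fun h N hh => hC h N fun ρ hρ => ?_⟩
  rw [ENNReal.coe_toNNReal hCt]
  calc _ ≤ ∫⁻ _ in ball (0 : E n) (2 * ρ) \ ball 0 ρ,
          N ^ p * (C₁ * ENNReal.ofReal ρ ^ (-d * p)) := by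
        refine setLIntegral_mono' (measurableSet_ball.diff measurableSet_ball) fun x hx => ?_
        have hx1 : ‖x‖ < 2 * ρ := by simpa using hx.1
        have hx2 : ρ ≤ ‖x‖ := by simpa using hx.2
        calc ‖h x‖ₑ ^ p ≤ (N * ENNReal.ofReal ‖x‖ ^ (-d)) ^ p := by
              gcongr; exact hh x (norm_pos_iff.1 (by linarith))
          _ = N ^ p * ENNReal.ofReal ‖x‖ ^ (-d * p) := by
              rw [ENNReal.mul_rpow_of_nonneg _ _ hp.le, ← ENNReal.rpow_mul]
          _ ≤ _ := by gcongr; exact hC₁ _ _ hρ (by linarith) (by linarith)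
    _ = N ^ p * (C₁ * ENNReal.ofReal ρ ^ (-d * p)) *
          volume (ball (0 : E n) (2 * ρ) \ ball 0 ρ) := setLIntegral_const _ _
    _ ≤ N ^ p * (C₁ * ENNReal.ofReal ρ ^ (-d * p)) *
          (2 ^ n * unitVol n * ENNReal.ofReal ρ ^ (n : ℝ)) := by
        gcongr; exact volume_annulus_le hρ
    _ = _ := by rw [ofReal_rpow_add hρ]; ring

lemma eq_zero_of_ofReal_rpow_le {s : ℝ} {K : ℝ≥0∞} (hK : K ≠ ⊤)
    (h : ∀ t : ℝ, 0 < t → ENNReal.ofReal t ^ s ≤ K) : s = 0 := by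
  by_contra hs
  have hpos : 0 < K.toReal + 1 := by positivity
  have := h ((K.toReal + 1) ^ s⁻¹) (by positivity)
  rw [ENNReal.ofReal_rpow_of_pos (by positivity), Real.rpow_inv_rpow hpos.le hs,
    ENNReal.ofReal_le_iff_le_toReal hK] at this
  linarith

/-- The characteristic function of a dyadic annulus. -/
noncomputable def annulusFn (n : ℕ) (𝕜 : Type*) [RCLike 𝕜] (t : ℝ) : E n → 𝕜 :=
  (ball 0 (2 * t) \ ball 0 t).indicator fun _ => 1

lemma aestronglyMeasurable_annulusFn (t : ℝ) : AEStronglyMeasurable (annulusFn n 𝕜 t) :=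
  aestronglyMeasurable_const.indicator (measurableSet_ball.diff measurableSet_ball)

/-- The homogeneity condition, necessary for the weak type boundedness of an operator of order
`α`. -/
lemma scaling_of_boundedOp (hn : 0 < n) {F : Type*} [ENorm F] [TopologicalSpace F]
    {T : (E n → 𝕜) → E n → F} {Dom : (E n → 𝕜) → Prop} {α p q lam₁ lam₂ β₁ β₂ : ℝ} (hp : 0 < p)
    (hq : 0 < q) (hlam₁ : 0 < lam₁)
    (hT : ∃ c : ℝ≥0, 0 < c ∧ ∀ t : ℝ, 0 < t → Dom (annulusFn n 𝕜 t) →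
      ∀ᵐ x, x ∈ ball (0 : E n) (2 * t) \ ball 0 t →
        c * ENNReal.ofReal t ^ α ≤ ‖T (annulusFn n 𝕜 t) x‖ₑ)
    (hB : BoundedOp T Dom (lmNorm p (samko lam₁) (powerWeight β₁ p))
      (wlmNorm q (samko lam₂) (powerWeight β₂ q))) :
    β₂ - β₁ - (n - lam₁) / p + (n - lam₂) / q + α = 0 := by
  obtain ⟨c, hc0, hc⟩ := hT
  obtain ⟨C, hC⟩ := hB
  set d := β₁ + (n - lam₁) / p with hd
  obtain ⟨C₁, hC₁⟩ := exists_lmNorm_le_of_le_rpow (n := n) (F := 𝕜) (β := β₁) hn hp hlam₁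
  obtain ⟨C₂, -, hC₂⟩ := exists_rpow_le_of_comparable (-d)
  obtain ⟨c₃, hc₃0, hc₃⟩ := exists_le_lintegral_annulus (n := n) hn (β₂ * q)
  have hnorm : ∀ t : ℝ, 0 < t →
      lmNorm p (samko lam₁) (powerWeight β₁ p) (annulusFn n 𝕜 t) ≤
        C₁ * (C₂ * ENNReal.ofReal t ^ d) := by
    intro t ht
    refine hC₁ _ _ fun x hx => ?_
    by_cases hxA : x ∈ ball (0 : E n) (2 * t) \ ball 0 t
    · have hx1 : ‖x‖ < 2 * t := by simpa using hxA.1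
      have hx2 : t ≤ ‖x‖ := by simpa using hxA.2
      rw [annulusFn, indicator_of_mem hxA, enorm_one]
      calc (1 : ℝ≥0∞) = ENNReal.ofReal t ^ d * ENNReal.ofReal t ^ (-d) := by
            rw [← ofReal_rpow_add ht]; simp
        _ ≤ ENNReal.ofReal t ^ d * (C₂ * ENNReal.ofReal ‖x‖ ^ (-d)) := by
            gcongr; exact hC₂ _ _ (by linarith) (by linarith) (by linarith)
        _ = _ := by ring
    · rw [annulusFn, indicator_of_notMem hxA, enorm_zero]; exact zero_le
  -- All powers of `t` are collected on the left; boundedness over all `t > 0` will force the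
  -- exponent to vanish.
  have hmain : ∀ t : ℝ, 0 < t → (c / 2 : ℝ≥0∞) ^ q * c₃ *
      ENNReal.ofReal t ^ ((α + β₂ - d) * q + n - lam₂) ≤
      (C * (C₁ * C₂)) ^ q * ENNReal.ofReal 2 ^ lam₂ := by
    intro t ht
    have hfin : lmNorm p (samko lam₁) (powerWeight β₁ p) (annulusFn n 𝕜 t) < ⊤ :=
      (hnorm t ht).trans_lt (ENNReal.mul_lt_top (by simp) (ENNReal.mul_lt_top (by simp)
        (ofReal_rpow_ne_top ht _).lt_top))
    obtain ⟨hD, -, hle⟩ := hC _ (aestronglyMeasurable_annulusFn t) hfin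
    -- Half the lower bound for the operator, so that the annulus lies a.e. in a strict superlevel
    -- set.
    set τ : ℝ≥0 := c / 2 * t.toNNReal ^ α with hτ
    have ht' : t.toNNReal ≠ 0 := by simpa using ht
    have hτ0 : 0 < τ := mul_pos (by positivity) (NNReal.rpow_pos (pos_iff_ne_zero.2 ht'))
    have hτc : (τ : ℝ≥0∞) = c / 2 * ENNReal.ofReal t ^ α := by
      rw [hτ, ENNReal.coe_mul, ENNReal.coe_div (by norm_num), ENNReal.coe_rpow_of_ne_zero ht',
        ENNReal.ofReal]
      rfl
    have hτlt : (τ : ℝ≥0∞) < c * ENNReal.ofReal t ^ α := by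
      rw [hτc]
      refine (ENNReal.mul_lt_mul_iff_left (ofReal_rpow_ne_zero ht _)
        (ofReal_rpow_ne_top ht _)).2 ?_
      exact ENNReal.half_lt_self (by simpa using hc0.ne') (by simp)
    have h1 := le_of_wlmNorm (lam := lam₂) (w := powerWeight β₂ q) hq (T (annulusFn n 𝕜 t))
      (by positivity : 0 < 2 * t) hτ0
    have h2 : c₃ * ENNReal.ofReal t ^ (β₂ * q + n) ≤
        ∫⁻ x in {x ∈ ball (0 : E n) (2 * t) | (τ : ℝ≥0∞) < ‖T (annulusFn n 𝕜 t) x‖ₑ},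
          ENNReal.ofReal (powerWeight β₂ q x) := by
      refine (hc₃ t ht).trans ?_
      calc _ = ∫⁻ x in ball (0 : E n) (2 * t) \ ball 0 t, ENNReal.ofReal (powerWeight β₂ q x) := by
            refine setLIntegral_congr_fun (measurableSet_ball.diff measurableSet_ball)
              fun x hx => ?_
            have hx2 : t ≤ ‖x‖ := by simpa using hx.2
            exact (ofReal_powerWeight (by linarith) _ _).symm
        _ ≤ _ := by
            refine lintegral_mono' (Measure.restrict_mono_ae ?_) le_rfl
            filter_upwards [hc t ht hD] with x hx hxA
            exact ⟨hxA.1, hτlt.trans_le (hx hxA)⟩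
    have h3 : (τ : ℝ≥0∞) ^ q * (c₃ * ENNReal.ofReal t ^ (β₂ * q + n)) ≤
        (C * (C₁ * (C₂ * ENNReal.ofReal t ^ d))) ^ q * ENNReal.ofReal (2 * t) ^ lam₂ := by
      refine (mul_le_mul' le_rfl h2).trans (h1.trans ?_)
      gcongr
      exact hle.trans (by gcongr; exact hnorm t ht)
    have hX : ENNReal.ofReal t ^ (d * q + lam₂) ≠ 0 := ofReal_rpow_ne_zero ht _
    have hX' : ENNReal.ofReal t ^ (d * q + lam₂) ≠ ⊤ := ofReal_rpow_ne_top ht _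
    rw [← ENNReal.mul_le_mul_iff_left hX hX']
    calc _ = (τ : ℝ≥0∞) ^ q * (c₃ * ENNReal.ofReal t ^ (β₂ * q + n)) := by
          rw [hτc, ENNReal.mul_rpow_of_nonneg _ _ hq.le, ← ENNReal.rpow_mul, mul_assoc,
            ← ofReal_rpow_add ht,
            show (α + β₂ - d) * q + n - lam₂ + (d * q + lam₂) = α * q + (β₂ * q + n) by ring,
            ofReal_rpow_add ht]
          ring
      _ ≤ _ := h3
      _ = _ := by
          rw [show (C : ℝ≥0∞) * (C₁ * (C₂ * ENNReal.ofReal t ^ d)) =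
            C * (C₁ * C₂) * ENNReal.ofReal t ^ d by ring, ENNReal.mul_rpow_of_nonneg _ _ hq.le,
            ← ENNReal.rpow_mul, ofReal_mul_rpow (by norm_num), ofReal_rpow_add ht]
          ring
  have hκ0 : (c / 2 : ℝ≥0∞) ^ q * c₃ ≠ 0 := by
    refine mul_ne_zero ?_ hc₃0
    simp [ENNReal.rpow_eq_zero_iff_of_pos hq, hc0.ne']
  have hR : (C * (C₁ * C₂) : ℝ≥0∞) ^ q * ENNReal.ofReal 2 ^ lam₂ ≠ ⊤ :=
    ENNReal.mul_ne_top (ENNReal.rpow_ne_top_of_nonneg hq.le (by finiteness))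
      (ofReal_rpow_ne_top (by norm_num) _)
  -- Finiteness of `c₃` is not part of its construction; it is read off from the inequality at `t =
  -- 1`.
  have hκt : (c / 2 : ℝ≥0∞) ^ q * c₃ ≠ ⊤ := by
    have := hmain 1 one_pos
    rw [ENNReal.ofReal_one, ENNReal.one_rpow, mul_one] at this
    exact ne_top_of_le_ne_top hR this
  have hs := eq_zero_of_ofReal_rpow_le (ENNReal.div_ne_top hR hκ0) fun t ht => by
    rw [ENNReal.le_div_iff_mul_le (.inl hκ0) (.inl hκt), mul_comm]
    exact hmain t ht
  have : (α + β₂ - d) + (n - lam₂) / q = 0 := by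
    field_simp
    linarith
  rw [hd] at this
  linarith

lemma lintegral_annulusFn_ball (t : ℝ) :
    ∫⁻ y in ball (0 : E n) (2 * t), ‖annulusFn n 𝕜 t y‖ₑ =
      volume (ball (0 : E n) (2 * t) \ ball 0 t) := by
  have hm : MeasurableSet (ball (0 : E n) (2 * t) \ ball 0 t) :=
    measurableSet_ball.diff measurableSet_ball
  simp only [annulusFn, enorm_indicator_eq_indicator_enorm, enorm_one]
  rw [lintegral_indicator hm, setLIntegral_one, Measure.restrict_apply hm,
    inter_eq_left.2 sdiff_subset]

lemma average_le_fracMax (α : ℝ) (f : E n → 𝕜) {x c : E n} {r : ℝ} (hx : x ∈ ball c r) :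
    (∫⁻ y in ball c r, ‖f y‖ₑ) / volume (ball c r) ^ (1 - α / n) ≤ fracMax α f x :=
  le_iSup₂_of_le c r (le_iSup_of_le hx le_rfl)

/-- The single ball `B(0, 2 t)` is a competitor for every `x` in the annulus. -/
lemma exists_le_fracMax_annulusFn (hn : 0 < n) {α : ℝ} (hαn : α < n) :
    ∃ c : ℝ≥0, 0 < c ∧ ∀ t : ℝ, 0 < t → ∀ x ∈ ball (0 : E n) (2 * t) \ ball 0 t,
        c * ENNReal.ofReal t ^ α ≤ ‖fracMax α (annulusFn n 𝕜 t) x‖ₑ := by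
  set K : ℝ≥0∞ := (unitVol n ^ (1 - α / n))⁻¹ * (unitVol n * ENNReal.ofReal 2 ^ (α - n)) with hK
  have hK0 : K ≠ 0 := mul_ne_zero (ENNReal.inv_ne_zero.2 (unitVol_rpow_ne_top _))
    (mul_ne_zero unitVol_ne_zero (ofReal_rpow_ne_zero (by norm_num) _))
  have hKt : K ≠ ⊤ := ENNReal.mul_ne_top (ENNReal.inv_ne_top.2 (unitVol_rpow_ne_zero _))
    (ENNReal.mul_ne_top unitVol_ne_top (ofReal_rpow_ne_top (by norm_num) _))
  refine ⟨K.toNNReal, ENNReal.toNNReal_pos hK0 hKt, fun t ht x hx => ?_⟩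
  rw [ENNReal.coe_toNNReal hKt, enorm_eq_self]
  calc K * ENNReal.ofReal t ^ α
      = (unitVol n ^ (1 - α / n))⁻¹ *
          (unitVol n * ENNReal.ofReal t ^ (n : ℝ) * ENNReal.ofReal (2 * t) ^ (α - n)) := by
        rw [ofReal_mul_rpow (by norm_num), hK]
        have : ENNReal.ofReal t ^ α = ENNReal.ofReal t ^ (n : ℝ) * ENNReal.ofReal t ^ (α - n) := by
          rw [← ofReal_rpow_add ht]; congr 1; ring
        rw [this]; ring
    _ ≤ (unitVol n ^ (1 - α / n))⁻¹ *
          ((∫⁻ y in ball (0 : E n) (2 * t), ‖annulusFn n 𝕜 t y‖ₑ) *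
            ENNReal.ofReal (2 * t) ^ (α - n)) := by
        rw [lintegral_annulusFn_ball]
        gcongr
        exact le_volume_annulus hn ht
    _ = (∫⁻ y in ball (0 : E n) (2 * t), ‖annulusFn n 𝕜 t y‖ₑ) /
          volume (ball (0 : E n) (2 * t)) ^ (1 - α / n) :=
        (div_volume_ball_rpow hn hαn _ _ (by positivity)).symm
    _ ≤ _ := average_le_fracMax α _ hx.1

lemma enorm_fracIntegrand_of_ne {α : ℝ} (f : E n → 𝕜) {x y : E n} (hxy : x ≠ y) :
    ‖fracIntegrand α f x y‖ₑ = ENNReal.ofReal ‖x - y‖ ^ (α - n) * ‖f y‖ₑ := by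
  have h : 0 < ‖x - y‖ := norm_pos_iff.2 (sub_ne_zero.2 hxy)
  rw [fracIntegrand, enorm_smul, ENNReal.ofReal_rpow_of_pos h, ← Real.rpow_neg h.le, neg_sub,
    Real.enorm_of_nonneg (by positivity)]

/-- For a nonnegative function, the norm of the fractional integral is the integral of the norm. -/
lemma enorm_fracInt_of_nonneg {α : ℝ} {f : E n → ℝ} (hf : ∀ y, 0 ≤ f y) {x : E n}
    (hi : Integrable (fracIntegrand α (fun y => (f y : 𝕜)) x)) :
    ‖fracInt α (fun y => (f y : 𝕜)) x‖ₑ =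
      ∫⁻ y, ‖fracIntegrand α (fun y => (f y : 𝕜)) x y‖ₑ := by
  have h1 : ∀ y, fracIntegrand α (fun y => (f y : 𝕜)) x y =
      (((‖x - y‖ ^ ((n : ℝ) - α))⁻¹ * f y : ℝ) : 𝕜) := fun y => by
    rw [fracIntegrand, RCLike.real_smul_eq_coe_mul, RCLike.ofReal_mul]
  have h0 : ∀ y, 0 ≤ (‖x - y‖ ^ ((n : ℝ) - α))⁻¹ * f y := fun y =>
    mul_nonneg (by positivity) (hf y)
  have hi' : Integrable fun y => (‖x - y‖ ^ ((n : ℝ) - α))⁻¹ * f y := by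
    have := hi.re
    simpa only [h1, RCLike.ofReal_re] using this
  have h2 : ∀ r : ℝ, ‖(r : 𝕜)‖ₑ = ‖r‖ₑ := fun r => by
    rw [← ofReal_norm, RCLike.norm_ofReal, ← Real.norm_eq_abs, ofReal_norm]
  rw [fracInt]
  simp only [h1, h2]
  rw [integral_ofReal, h2, Real.enorm_of_nonneg (integral_nonneg h0),
    ofReal_integral_eq_lintegral_ofReal hi' (Filter.Eventually.of_forall h0)]
  exact lintegral_congr fun y => (Real.enorm_of_nonneg (h0 y)).symm

/-- Two points of the annulus are at distance less than `4 t`. The definedness hypothesis matters: a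
divergent Bochner integral would be `0`. -/
lemma exists_le_fracInt_annulusFn (hn : 0 < n) {α : ℝ} (hαn : α < n) :
    ∃ c : ℝ≥0, 0 < c ∧ ∀ t : ℝ, 0 < t → FracIntDefined α (annulusFn n 𝕜 t) →
      ∀ᵐ x, x ∈ ball (0 : E n) (2 * t) \ ball 0 t →
        c * ENNReal.ofReal t ^ α ≤ ‖fracInt α (annulusFn n 𝕜 t) x‖ₑ := by
  set K : ℝ≥0∞ := ENNReal.ofReal 4 ^ (α - n) * unitVol n with hK
  have hK0 : K ≠ 0 := mul_ne_zero (ofReal_rpow_ne_zero (by norm_num) _) unitVol_ne_zero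
  have hKt : K ≠ ⊤ := ENNReal.mul_ne_top (ofReal_rpow_ne_top (by norm_num) _) unitVol_ne_top
  refine ⟨K.toNNReal, ENNReal.toNNReal_pos hK0 hKt, fun t ht hdef => ?_⟩
  filter_upwards [hdef] with x hx hxA
  have heq : annulusFn n 𝕜 t = fun y => (((ball (0 : E n) (2 * t) \ ball 0 t).indicator
      (fun _ => (1 : ℝ)) y : ℝ) : 𝕜) := by
    funext y
    by_cases hy : y ∈ ball (0 : E n) (2 * t) \ ball 0 t
    · rw [annulusFn, indicator_of_mem hy, indicator_of_mem hy, RCLike.ofReal_one]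
    · rw [annulusFn, indicator_of_notMem hy, indicator_of_notMem hy, RCLike.ofReal_zero]
  have hnorm : ‖fracInt α (annulusFn n 𝕜 t) x‖ₑ =
      ∫⁻ y, ‖fracIntegrand α (annulusFn n 𝕜 t) x y‖ₑ := by
    rw [heq] at hx ⊢
    exact enorm_fracInt_of_nonneg (fun y => indicator_nonneg (fun _ _ => zero_le_one) y) hx
  rw [hnorm, ENNReal.coe_toNNReal hKt]
  have hx1 : ‖x‖ < 2 * t := by simpa using hxA.1
  calc K * ENNReal.ofReal t ^ α
      = ENNReal.ofReal (4 * t) ^ (α - n) * (unitVol n * ENNReal.ofReal t ^ (n : ℝ)) := by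
        rw [ofReal_mul_rpow (by norm_num), hK]
        have : ENNReal.ofReal t ^ α = ENNReal.ofReal t ^ (n : ℝ) * ENNReal.ofReal t ^ (α - n) := by
          rw [← ofReal_rpow_add ht]; congr 1; ring
        rw [this]; ring
    _ ≤ ENNReal.ofReal (4 * t) ^ (α - n) * volume (ball (0 : E n) (2 * t) \ ball 0 t) := by
        gcongr; exact le_volume_annulus hn ht
    _ = ∫⁻ _ in ball (0 : E n) (2 * t) \ ball 0 t, ENNReal.ofReal (4 * t) ^ (α - n) :=
        (setLIntegral_const _ _).symm
    _ ≤ ∫⁻ y in ball (0 : E n) (2 * t) \ ball 0 t, ‖fracIntegrand α (annulusFn n 𝕜 t) x y‖ₑ := by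
        refine lintegral_mono_ae ?_
        filter_upwards [ae_restrict_mem (measurableSet_ball.diff measurableSet_ball),
          ae_restrict_of_ae (measure_eq_zero_iff_ae_notMem.1 (volume_singleton_eq_zero hn x))]
          with y hy hne
        have hy1 : ‖y‖ < 2 * t := by simpa using hy.1
        rw [enorm_fracIntegrand_of_ne _ (Ne.symm hne), annulusFn, indicator_of_mem hy, enorm_one,
          mul_one]
        refine rpow_le_rpow_of_nonpos' (ENNReal.ofReal_le_ofReal ?_) (by linarith)
        linarith [norm_sub_le x y]
    _ ≤ _ := setLIntegral_le_lintegral _ _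

/-- The power `|x| ^ (-d)`. -/
noncomputable def powerFn (n : ℕ) (𝕜 : Type*) [RCLike 𝕜] (d : ℝ) (x : E n) : 𝕜 :=
  ((‖x‖ ^ (-d) : ℝ) : 𝕜)

lemma enorm_powerFn {d : ℝ} {x : E n} (hx : 0 < ‖x‖) :
    ‖powerFn n 𝕜 d x‖ₑ = ENNReal.ofReal ‖x‖ ^ (-d) := by
  rw [powerFn, ← ofReal_norm, RCLike.norm_ofReal, abs_of_nonneg (by positivity),
    ENNReal.ofReal_rpow_of_pos hx]

lemma aestronglyMeasurable_powerFn (d : ℝ) : AEStronglyMeasurable (powerFn n 𝕜 d) := by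
  have h : Measurable fun x : E n => (‖x‖ ^ (-d) : ℝ) := by fun_prop
  exact (RCLike.measurable_ofReal.comp h).aestronglyMeasurable

lemma lmNorm_powerFn_lt_top (hn : 0 < n) {p lam β : ℝ} (hp : 0 < p) (hlam : 0 < lam) :
    lmNorm p (samko lam) (powerWeight β p) (powerFn n 𝕜 (β + (n - lam) / p)) < ⊤ := by
  obtain ⟨C, hC⟩ := exists_lmNorm_le_of_le_rpow (n := n) (F := 𝕜) (β := β) hn hp hlam
  refine (hC _ 1 fun x hx => ?_).trans_lt (ENNReal.mul_lt_top (by simp) (by simp))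
  rw [one_mul, enorm_powerFn (norm_pos_iff.2 hx)]

lemma setLIntegral_enorm_powerFn (hn : 0 < n) (d : ℝ) (S : Set (E n)) :
    ∫⁻ x in S, ‖powerFn n 𝕜 d x‖ₑ = ∫⁻ x in S, ENNReal.ofReal ‖x‖ ^ (-d) :=
  lintegral_congr_ae (ae_restrict_of_ae ((ae_norm_pos hn).mono fun _ hx => enorm_powerFn hx))

lemma lt_of_locallyIntegrable_powerFn (hn : 0 < n) {d : ℝ}
    (h : LocallyIntegrable (powerFn n 𝕜 d)) : d < n := by
  by_contra! hd
  obtain ⟨U, hU, hint⟩ := h 0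
  obtain ⟨ε, hε, hsub⟩ := Metric.mem_nhds_iff.1 hU
  have h1 := (hint.mono_set hsub).2
  rw [HasFiniteIntegral, setLIntegral_enorm_powerFn hn,
    lintegral_ball_rpow_eq_top hn (by linarith) hε] at h1
  exact lt_irrefl _ h1

/-- The averages over `B(0, 2 r)` grow at least like `r ^ (α - d)`, and these balls contain any
given `x` once `r` is large. -/
lemma fracMax_powerFn_eq_top (hn : 0 < n) {α d : ℝ} (hαn : α < n) (hd : d < α) (x : E n) :
    fracMax α (powerFn n 𝕜 d) x = ⊤ := by
  obtain ⟨c, hc0, hc⟩ := exists_le_lintegral_annulus (n := n) hn (-d)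
  set K : ℝ≥0∞ := (unitVol n ^ (1 - α / n))⁻¹ * (c * ENNReal.ofReal 2 ^ (α - n)) with hK
  have hK0 : K ≠ 0 := mul_ne_zero (ENNReal.inv_ne_zero.2 (unitVol_rpow_ne_top _))
    (mul_ne_zero hc0 (ofReal_rpow_ne_zero (by norm_num) _))
  have key : ∀ r : ℝ, 0 < r → ‖x‖ < r →
      K * ENNReal.ofReal r ^ (α - d) ≤ fracMax α (powerFn n 𝕜 d) x := by
    intro r hr hxr
    calc K * ENNReal.ofReal r ^ (α - d) = (unitVol n ^ (1 - α / n))⁻¹ *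
          (c * ENNReal.ofReal r ^ (-d + n) * ENNReal.ofReal (2 * r) ^ (α - n)) := by
          rw [ofReal_mul_rpow (by norm_num), hK,
            show α - d = (-d + n) + (α - n) by ring, ofReal_rpow_add hr]
          ring
      _ ≤ (unitVol n ^ (1 - α / n))⁻¹ * ((∫⁻ y in ball (0 : E n) (2 * r),
            ‖powerFn n 𝕜 d y‖ₑ) * ENNReal.ofReal (2 * r) ^ (α - n)) := by
          rw [setLIntegral_enorm_powerFn hn]
          gcongr
          exact (hc r hr).trans (lintegral_mono_set sdiff_subset)
      _ = _ := (div_volume_ball_rpow hn hαn _ _ (by positivity)).symm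
      _ ≤ _ := average_le_fracMax α _ (by rw [mem_ball_zero_iff]; linarith)
  by_contra htop
  have hdiv : fracMax α (powerFn n 𝕜 d) x / K ≠ ⊤ := ENNReal.div_ne_top htop hK0
  set L := (fracMax α (powerFn n 𝕜 d) x / K).toReal
  have hs : 0 < α - d := by linarith
  have hL : 0 ≤ L := ENNReal.toReal_nonneg
  set r := max (‖x‖ + 1) ((L + 1) ^ (α - d)⁻¹) with hr
  have hr0 : 0 < r := lt_max_of_lt_left (by positivity)
  have h1 := key r hr0 (lt_max_of_lt_left (by linarith))
  have hKt : K ≠ ⊤ := fun h => by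
    rw [h, ENNReal.top_mul (ofReal_rpow_ne_zero hr0 _), top_le_iff] at h1
    exact htop h1
  rw [mul_comm, ← ENNReal.le_div_iff_mul_le (.inl hK0) (.inl hKt),
    ENNReal.ofReal_rpow_of_pos hr0, ENNReal.ofReal_le_iff_le_toReal hdiv] at h1
  have h2 : L + 1 ≤ r ^ (α - d) := by
    rw [← Real.rpow_inv_le_iff_of_pos (by positivity) hr0.le hs]
    exact le_max_right _ _
  change r ^ (α - d) ≤ L at h1
  linarith

/-- One point `x ≠ 0` of convergence suffices. For `|y| ≥ 2 |x|` the integrand is at least a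
multiple of `|y| ^ (α - n - d)`, not integrable at infinity if `d ≤ α`; for `|y| < |x|` it is at
least a multiple of `|y| ^ (-d)`, not integrable at `0` if `d ≥ n`. -/
lemma bounds_of_fracIntDefined_powerFn (hn : 0 < n) {α d : ℝ} (hαn : α < n)
    (h : FracIntDefined α (powerFn n 𝕜 d)) : α < d ∧ d < n := by
  obtain ⟨x, hx, hx0⟩ := (h.and (ae_norm_pos hn)).exists
  have hfin : ∫⁻ y, ‖fracIntegrand α (powerFn n 𝕜 d) x y‖ₑ < ⊤ := hx.2
  have hc0 : ENNReal.ofReal 2 ^ (α - n) ≠ 0 := ofReal_rpow_ne_zero (by norm_num) _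
  have hx2 : ENNReal.ofReal (2 * ‖x‖) ^ (α - n) ≠ 0 := ofReal_rpow_ne_zero (by positivity) _
  constructor
  · by_contra! hd
    refine hfin.ne (top_le_iff.1 (le_trans ?_
      (setLIntegral_le_lintegral (ball 0 (2 * ‖x‖))ᶜ _)))
    calc (⊤ : ℝ≥0∞) = ENNReal.ofReal 2 ^ (α - n) *
          ∫⁻ y in (ball (0 : E n) (2 * ‖x‖))ᶜ, ENNReal.ofReal ‖y‖ ^ ((α - n) + -d) := by
          rw [lintegral_compl_ball_rpow_eq_top hn (by linarith) (by positivity),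
            ENNReal.mul_top hc0]
      _ = ∫⁻ y in (ball (0 : E n) (2 * ‖x‖))ᶜ, ENNReal.ofReal 2 ^ (α - n) *
            ENNReal.ofReal ‖y‖ ^ ((α - n) + -d) := by
          rw [lintegral_const_mul' _ _ (ofReal_rpow_ne_top (by norm_num) _)]
      _ ≤ _ := by
          refine setLIntegral_mono' measurableSet_ball.compl fun y hy => ?_
          have hy1 : 2 * ‖x‖ ≤ ‖y‖ := by simpa using hy
          have hy0 : 0 < ‖y‖ := by linarith
          have hne : x ≠ y := by rintro rfl; linarith
          rw [enorm_fracIntegrand_of_ne _ hne, enorm_powerFn hy0, ofReal_rpow_add hy0, ← mul_assoc,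
            ← ofReal_mul_rpow (by norm_num)]
          refine mul_le_mul' (rpow_le_rpow_of_nonpos' (ENNReal.ofReal_le_ofReal ?_)
            (by linarith)) le_rfl
          linarith [norm_sub_le x y]
  · by_contra! hd
    refine hfin.ne (top_le_iff.1 (le_trans ?_
      (setLIntegral_le_lintegral (ball 0 ‖x‖) _)))
    calc (⊤ : ℝ≥0∞) = ENNReal.ofReal (2 * ‖x‖) ^ (α - n) *
          ∫⁻ y in ball (0 : E n) ‖x‖, ENNReal.ofReal ‖y‖ ^ (-d) := by
          rw [lintegral_ball_rpow_eq_top hn (by linarith) hx0, ENNReal.mul_top hx2]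
      _ = ∫⁻ y in ball (0 : E n) ‖x‖, ENNReal.ofReal (2 * ‖x‖) ^ (α - n) *
            ENNReal.ofReal ‖y‖ ^ (-d) := by
          rw [lintegral_const_mul' _ _ (ofReal_rpow_ne_top (by positivity) _)]
      _ ≤ _ := by
          refine lintegral_mono_ae ?_
          filter_upwards [ae_restrict_mem measurableSet_ball, ae_restrict_of_ae (ae_norm_pos hn)]
            with y hy hy0
          have hy1 : ‖y‖ < ‖x‖ := by simpa using hy
          have hne : x ≠ y := by rintro rfl; exact lt_irrefl _ hy1
          rw [enorm_fracIntegrand_of_ne _ hne, enorm_powerFn hy0]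
          refine mul_le_mul' (rpow_le_rpow_of_nonpos' (ENNReal.ofReal_le_ofReal ?_)
            (by linarith)) le_rfl
          linarith [norm_sub_le x y]

/-! ### Necessity of the conditions and conclusion -/

lemma BoundedOp.weak {F : Type*} [ENorm F] [TopologicalSpace F]
    {T : (E n → 𝕜) → E n → F} {Dom : (E n → 𝕜) → Prop} {N₁ : (E n → 𝕜) → ℝ≥0∞} {q lam : ℝ}
    {w : E n → ℝ} (hq : 0 < q)
    (hF : ∀ h : E n → F, AEStronglyMeasurable h volume → AEMeasurable fun x => ‖h x‖ₑ)
    (hB : BoundedOp T Dom N₁ (lmNorm q (samko lam) w)) :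
    BoundedOp T Dom N₁ (wlmNorm q (samko lam) w) := by
  obtain ⟨C, hC⟩ := hB
  refine ⟨C, fun f hf hfin => ?_⟩
  obtain ⟨h1, h2, h3⟩ := hC f hf hfin
  exact ⟨h1, h2, (wlmNorm_le_lmNorm hq (hF _ h2)).trans h3⟩

lemma conditions_of_boundedOp_fracMax (hn : 0 < n) {α p q lam₁ lam₂ β₁ β₂ : ℝ} (hαn : α < n)
    (hp : 0 < p) (hq : 0 < q) (hlam₁ : 0 < lam₁)
    (hB : BoundedOp (n := n) (𝕜 := 𝕜) (fracMax α) FracMaxDefined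
      (lmNorm p (samko lam₁) (powerWeight β₁ p)) (wlmNorm q (samko lam₂) (powerWeight β₂ q))) :
    β₂ - β₁ - (n - lam₁) / p + (n - lam₂) / q + α = 0 ∧
      α ≤ β₁ + (n - lam₁) / p ∧ β₁ + (n - lam₁) / p < n := by
  obtain ⟨c, hc0, hc⟩ := exists_le_fracMax_annulusFn (n := n) (𝕜 := 𝕜) hn hαn
  refine ⟨scaling_of_boundedOp hn hp hq hlam₁
    ⟨c, hc0, fun t ht _ => Filter.Eventually.of_forall (hc t ht)⟩ hB, ?_⟩
  obtain ⟨C, hC⟩ := hB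
  have hfin := lmNorm_powerFn_lt_top (n := n) (𝕜 := 𝕜) (β := β₁) hn hp hlam₁
  obtain ⟨h1, -, h2⟩ := hC _ (aestronglyMeasurable_powerFn _) hfin
  refine ⟨?_, lt_of_locallyIntegrable_powerFn hn h1⟩
  by_contra! hd
  obtain ⟨x, hx⟩ := (ae_enorm_lt_top_of_wlmNorm hn hq
    (h2.trans_lt (ENNReal.mul_lt_top (by simp) hfin))).exists
  rw [fracMax_powerFn_eq_top hn hαn hd] at hx
  exact lt_irrefl _ hx

/-- The norm inequality serves only for homogeneity; the range of `d` follows from mere convergence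
on `|x| ^ (-d)`. -/
lemma conditions_of_boundedOp_fracInt (hn : 0 < n) {α p q lam₁ lam₂ β₁ β₂ : ℝ} (hαn : α < n)
    (hp : 0 < p) (hq : 0 < q) (hlam₁ : 0 < lam₁)
    (hB : BoundedOp (n := n) (𝕜 := 𝕜) (fracInt α) (FracIntDefined α)
      (lmNorm p (samko lam₁) (powerWeight β₁ p)) (wlmNorm q (samko lam₂) (powerWeight β₂ q))) :
    β₂ - β₁ - (n - lam₁) / p + (n - lam₂) / q + α = 0 ∧
      α < β₁ + (n - lam₁) / p ∧ β₁ + (n - lam₁) / p < n := by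
  refine ⟨scaling_of_boundedOp hn hp hq hlam₁ (exists_le_fracInt_annulusFn hn hαn) hB, ?_⟩
  obtain ⟨C, hC⟩ := hB
  exact bounds_of_fracIntDefined_powerFn hn hαn
    (hC _ (aestronglyMeasurable_powerFn _) (lmNorm_powerFn_lt_top hn hp hlam₁)).1

/-- The condition `p γ < n` says `γ/n < 1/p`, that is `1/q > 0`. -/
lemma exponent_pos {p q γ : ℝ} (hn : 0 < n) (hp : 1 ≤ p) (hpγ : p * γ < n)
    (hq : 1 / p - 1 / q = γ / n) : 0 < q := by
  have hn' : (0 : ℝ) < n := by exact_mod_cast hn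
  have hp0 : 0 < p := by linarith
  have h : 0 < 1 / q := by
    have : γ / n < 1 / p := by
      rw [div_lt_div_iff₀ hn' hp0]; linarith
    linarith
  exact one_div_pos.1 h

lemma weight_exponent_eq {α d q lam β : ℝ} (hq : 0 < q)
    (h : β - d + (n - lam) / q + α = 0) : β * q + ((α - d) * q + n) = lam := by
  field_simp at h
  linarith

end LocalMorrey

open LocalMorrey
theorem theorem7p3 {𝕜 : Type*} [RCLike 𝕜] {n : ℕ} {α γ p q lam₁ lam₂ β₁ β₂ : ℝ}
    (hα : 0 < α) (hαn : α < n) (hγ : 0 ≤ γ) (hγα : γ ≤ α)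
    (hp : 1 ≤ p) (hpγ : p * γ < n) (hq : 1 / p - 1 / q = γ / n)
    (hlam₁ : 0 < lam₁) (hlam₂ : 0 < lam₂) :
    -- the fractional maximal operator, strong type for `p > 1` and weak type for `p = 1`
    ((1 < p →
      (BoundedOp (n := n) (𝕜 := 𝕜) (fracMax α) FracMaxDefined
          (lmNorm p (samko lam₁) (powerWeight β₁ p)) (lmNorm q (samko lam₂) (powerWeight β₂ q)) ↔
        β₂ - β₁ - (n - lam₁) / p + (n - lam₂) / q + α = 0 ∧
          α ≤ β₁ + (n - lam₁) / p ∧ β₁ + (n - lam₁) / p < n)) ∧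
    (p = 1 →
      (BoundedOp (n := n) (𝕜 := 𝕜) (fracMax α) FracMaxDefined
          (lmNorm p (samko lam₁) (powerWeight β₁ p)) (wlmNorm q (samko lam₂) (powerWeight β₂ q)) ↔
        β₂ - β₁ - (n - lam₁) / p + (n - lam₂) / q + α = 0 ∧
          α ≤ β₁ + (n - lam₁) / p ∧ β₁ + (n - lam₁) / p < n))) ∧
    -- the fractional integral, strong type for `p > 1` and weak type for `p = 1`
    ((1 < p →
      (BoundedOp (n := n) (𝕜 := 𝕜) (fracInt α) (FracIntDefined α)
          (lmNorm p (samko lam₁) (powerWeight β₁ p)) (lmNorm q (samko lam₂) (powerWeight β₂ q)) ↔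
        β₂ - β₁ - (n - lam₁) / p + (n - lam₂) / q + α = 0 ∧
          α < β₁ + (n - lam₁) / p ∧ β₁ + (n - lam₁) / p < n)) ∧
    (p = 1 →
      (BoundedOp (n := n) (𝕜 := 𝕜) (fracInt α) (FracIntDefined α)
          (lmNorm p (samko lam₁) (powerWeight β₁ p)) (wlmNorm q (samko lam₂) (powerWeight β₂ q)) ↔
        β₂ - β₁ - (n - lam₁) / p + (n - lam₂) / q + α = 0 ∧
          α < β₁ + (n - lam₁) / p ∧ β₁ + (n - lam₁) / p < n))) := by
  have hn : 0 < n := by exact_mod_cast hα.trans hαn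
  have hp0 : 0 < p := by linarith
  have hq0 : 0 < q := exponent_pos hn hp hpγ hq
  refine ⟨⟨fun hp1 => ⟨fun hB => ?_, fun ⟨h1, h2, h3⟩ => ?_⟩,
    fun hp1 => ⟨fun hB => ?_, fun ⟨h1, h2, h3⟩ => ?_⟩⟩,
    ⟨fun hp1 => ⟨fun hB => ?_, fun ⟨h1, h2, h3⟩ => ?_⟩,
    fun hp1 => ⟨fun hB => ?_, fun ⟨h1, h2, h3⟩ => ?_⟩⟩⟩
  · exact conditions_of_boundedOp_fracMax hn hαn hp0 hq0 hlam₁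
      (hB.weak hq0 fun h hh => by simpa using hh.aemeasurable)
  · exact boundedOp_fracMax hn hp hαn (controlsLocal_lmNorm hn hp1 hα hγ hγα hq0 hq hlam₂
      (weight_exponent_eq hq0 (by linarith))) h2 h3
  · exact conditions_of_boundedOp_fracMax hn hαn hp0 hq0 hlam₁ hB
  · subst hp1
    exact boundedOp_fracMax hn hp hαn (controlsLocal_wlmNorm hn hα hγ hγα hq0 hq hlam₂
      (weight_exponent_eq hq0 (by linarith))) h2 h3
  · exact conditions_of_boundedOp_fracInt hn hαn hp0 hq0 hlam₁
      (hB.weak hq0 fun h hh => hh.enorm)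
  · exact boundedOp_fracInt hn hp hαn hα hγ hγα hq0 hq (controlsLocal_lmNorm hn hp1 hα hγ hγα
      hq0 hq hlam₂ (weight_exponent_eq hq0 (by linarith))) h2 h3
  · exact conditions_of_boundedOp_fracInt hn hαn hp0 hq0 hlam₁ hB
  · subst hp1
    exact boundedOp_fracInt hn hp hαn hα hγ hγα hq0 hq (controlsLocal_wlmNorm hn hα hγ hγα
      hq0 hq hlam₂ (weight_exponent_eq hq0 (by linarith))) h2 h3
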